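/- Let $K=\mathbb R$ or $K=\mathbb C$. For $f=\sum a_{ij}x^iy^j\in K[[x,y]]$ let $\Gamma(f)$, the Newton polygon of $f$, be the boundary in $\mathbb R^2$ of the convex hull of $\bigcup_{a_{ij}\neq 0}\big((i,j)+\mathbb R_{\ge 0}^2\big)$. Its faces are its compact edges, i.e. the maximal non-degenerate compact segments contained in $\Gamma(f)$. The principal part of $f$ is the sum of those terms $a_{ij}x^iy^j$ of $f$ for which $(i,j)$ lies on the compact part of $\Gamma(f)$ (its faces and vertices). The series $f$ is called non-degenerate if its Milnor number $\dim_K K[[x,y]]/\langle \partial f/\partial x,\partial f/\partial y\rangle$ is finite. Two series $f,g\in K[[x,y]]$ are right equivalent if there is a $K$-algebra automorphism $\phi$ of $K[[x,y]]$ with $\phi(f)=g$. Let $a,b\in\mathbb N$ and $0\neq\lambda\in K$, put $f_0=x^a+\lambda x^2y^2+y^b$, and suppose that $\Gamma(f_0)$ has exactly two faces. Then every non-degenerate power series $f\in K[[x,y]]$ with principal part $f_0$ is right equivalent to $f_0$. -/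

import Mathlib

noncomputable section

namespace PlaneSeries

/-- Formal power series `K[[x, y]]`, with `x = X 0` and `y = X 1`. -/
abbrev Series (K : Type*) := MvPowerSeries (Fin 2) K

/-- `f` and `g` are right equivalent: some `K`-algebra automorphism of `K[[x, y]]` maps `f` to
`g`. -/
def RightEquivalent {K : Type*} [Field K] (f g : Series K) : Prop :=
  ∃ φ : Series K ≃ₐ[K] Series K, φ f = g

/-- The Jacobian ideal, generated by the partial derivatives of `f`. -/
def jacobianIdeal {K : Type*} [Field K] (f : Series K) : Ideal (Series K) :=
  Ideal.span {MvPowerSeries.pderiv K 0 f, MvPowerSeries.pderiv K 1 f}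

/-- `f` is non-degenerate: its Milnor number, the `K`-dimension of the local algebra
`K[[x, y]] / Jac f`, is finite. -/
def IsNondegenerate {K : Type*} [Field K] (f : Series K) : Prop :=
  Module.Finite K (Series K ⧸ jacobianIdeal f)

/-- The exponent vector of a monomial as a point of the real plane. -/
def expPoint (e : Fin 2 →₀ ℕ) : ℝ × ℝ := ((e 0 : ℝ), (e 1 : ℝ))

/-- The convex hull of the union of the quadrants `(i, j) + ℝ²₊` over the monomials `x ^ i y ^ j`
of `f`. In `ℝ × ℝ` the order is coordinatewise, so that `Set.Ici p` is the quadrant at `p`. -/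
def newtonPolyhedron {K : Type*} [Field K] (f : Series K) : Set (ℝ × ℝ) :=
  convexHull ℝ (⋃ e ∈ {e : Fin 2 →₀ ℕ | MvPowerSeries.coeff e f ≠ 0}, Set.Ici (expPoint e))

/-- The Newton polygon `Γ(f)`: the boundary of that convex hull. It contains two unbounded
rays. -/
def newtonPolygon {K : Type*} [Field K] (f : Series K) : Set (ℝ × ℝ) :=
  frontier (newtonPolyhedron f)

/-- The faces of `Γ(f)`: its compact edges, that is, the non-degenerate compact segments contained
in `Γ(f)` that are not part of a longer one (so pieces of the unbounded rays do not count). -/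
def newtonFaces {K : Type*} [Field K] (f : Series K) : Set (Set (ℝ × ℝ)) :=
  {Δ | Maximal (fun S : Set (ℝ × ℝ) =>
    S ⊆ newtonPolygon f ∧ ∃ p q : ℝ × ℝ, p ≠ q ∧ S = segment ℝ p q) Δ}

/-- The compact part of `Γ(f)`: the faces together with the vertices. (The vertices add something
only if there are no faces, in which case there is at most one vertex.) -/
def compactPart {K : Type*} [Field K] (f : Series K) : Set (ℝ × ℝ) :=
  ⋃₀ newtonFaces f ∪ (newtonPolyhedron f).extremePoints ℝ

open Classical in
/-- The principal part of `f`: the sum of the terms of `f` whose exponents lie on the compact part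
of the Newton polygon of `f`. -/
def principalPart {K : Type*} [Field K] (f : Series K) : Series K :=
  fun e => if expPoint e ∈ compactPart f then MvPowerSeries.coeff e f else 0

/-- The series `x ^ a + c x² y² + y ^ b`. -/
def cuspForm {K : Type*} [Field K] (a b : ℕ) (c : K) : Series K :=
  MvPowerSeries.X 0 ^ a +
    MvPowerSeries.C c * MvPowerSeries.X 0 ^ 2 * MvPowerSeries.X 1 ^ 2 +
    MvPowerSeries.X 1 ^ b

end PlaneSeries

end

/-! Write `a = p + 2` and `b = q + 2`. If `(2, 2)` were not strictly below the line from `(a, 0)` to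
`(0, b)`, there would be at most one face (`lt_of_ncard_newtonFaces`); so two faces force `p * q >
4`. Each edge then defines a linear weight, and both are scaled so that their edge has the same
value `d = 2 (p + 2) (q + 2)`. Requiring both weights to be at least `n` gives the Newton
filtration, and `f - f₀` lies in its step `d + 1` (`sub_mem_newtonIdeal`).

These higher terms are removed one degree at a time. The infinitesimal statement is
`newtonIdeal_le_tangentIdeal`: for `k ≥ 1`, every series of Newton weight at least `d + k` is `u
∂f₀/∂x + v ∂f₀/∂y` modulo weight `d + k + 1`, where the vector field `u ∂/∂x + v ∂/∂y` raises both
weights by at least `k`. For monomials this is a computation: modulo the partial derivatives, `x²y`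
is a multiple of `y ^ (q + 1)` and `xy²` a multiple of `x ^ (p + 1)`. Such a replacement keeps one
weight and strictly raises the other. The difference of the two weights of `x ^ i y ^ j` is `(p q -
4) (i - j)`, so the side of the diagonal tells which replacement to use.

By a first-order Taylor estimate (`FirstOrder`), adding `(u, v)` to the current substitution
corrects the error up to the next degree. The substitutions converge, and the limit is an
automorphism because it is the identity modulo higher weight (`exists_algEquiv`). -/

noncomputable section

namespace PlaneSeries

open MvPowerSeries

/-! ### Weight filtrations, limits, and first-order expansion. -/

section

variable {K : Type*} [Field K]

/-- The weight of the monomial with exponent `e`. -/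
def expWeight (w : Fin 2 → ℕ) (e : Fin 2 →₀ ℕ) : ℕ := e 0 * w 0 + e 1 * w 1

lemma expWeight_add (w : Fin 2 → ℕ) (d e : Fin 2 →₀ ℕ) :
    expWeight w (d + e) = expWeight w d + expWeight w e := by
  simp only [expWeight, Finsupp.add_apply]; ring

/-- The ideal of series of weighted order at least `n`. -/
def weightIdeal (K : Type*) [Field K] (w : Fin 2 → ℕ) (n : ℕ) : Ideal (Series K) where
  carrier := {g | ∀ e, coeff e g ≠ 0 → n ≤ expWeight w e}
  zero_mem' := by simp
  add_mem' := by
    intro g h hg hh e he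
    by_cases h0 : coeff e g = 0
    · exact hh e fun h1 => he (by simp [h0, h1])
    · exact hg e h0
  smul_mem' := by
    classical
    intro r g hg e he
    rw [smul_eq_mul, coeff_mul] at he
    obtain ⟨⟨x, y⟩, hxy, hne⟩ := Finset.exists_ne_zero_of_sum_ne_zero he
    rw [← Finset.HasAntidiagonal.mem_antidiagonal.1 hxy, expWeight_add]
    exact (hg y (right_ne_zero_of_mul hne)).trans (Nat.le_add_left _ _)

variable {w w₁ w₂ : Fin 2 → ℕ} {m n k : ℕ}

lemma coeff_eq_of_sub_mem {g h : Series K} (hgh : g - h ∈ weightIdeal K w n) {e : Fin 2 →₀ ℕ}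
    (he : expWeight w e < n) : coeff e g = coeff e h := by
  by_contra hne
  exact he.not_ge (hgh e (by rwa [map_sub, sub_ne_zero]))

lemma weightIdeal_mono (hmn : m ≤ n) : weightIdeal K w n ≤ weightIdeal K w m :=
  fun _ hg e he => hmn.trans (hg e he)

lemma mul_mem_weightIdeal {g h : Series K} (hg : g ∈ weightIdeal K w m)
    (hh : h ∈ weightIdeal K w n) : g * h ∈ weightIdeal K w (m + n) := by
  classical
  intro e he
  rw [coeff_mul] at he
  obtain ⟨⟨x, y⟩, hxy, hne⟩ := Finset.exists_ne_zero_of_sum_ne_zero he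
  rw [← Finset.HasAntidiagonal.mem_antidiagonal.1 hxy, expWeight_add]
  exact add_le_add (hg x (left_ne_zero_of_mul hne)) (hh y (right_ne_zero_of_mul hne))

lemma monomial_mem_weightIdeal {e : Fin 2 →₀ ℕ} (r : K) (h : n ≤ expWeight w e) :
    monomial e r ∈ weightIdeal K w n := by
  classical
  intro d hd
  rw [coeff_monomial] at hd
  split_ifs at hd with hde
  · rwa [hde]
  · exact absurd rfl hd

lemma X_mem_weightIdeal (s : Fin 2) : (X s : Series K) ∈ weightIdeal K w (w s) := by
  refine monomial_mem_weightIdeal _ ?_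
  fin_cases s <;> simp [expWeight]

lemma eq_zero_of_forall_mem {g : Series K} (h : ∀ n, g ∈ weightIdeal K w n) : g = 0 := by
  ext e
  by_contra hne
  exact absurd (h (expWeight w e + 1) e hne) (by omega)

/-- A sequence that is Cauchy for two weight filtrations has a common limit. -/
lemma exists_limit {s : ℕ → Series K} {c₁ c₂ : ℕ}
    (h₁ : ∀ k, s (k + 1) - s k ∈ weightIdeal K w₁ (c₁ + k))
    (h₂ : ∀ k, s (k + 1) - s k ∈ weightIdeal K w₂ (c₂ + k)) :
    ∃ l : Series K, (∀ k, l - s k ∈ weightIdeal K w₁ (c₁ + k)) ∧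
      ∀ k, l - s k ∈ weightIdeal K w₂ (c₂ + k) := by
  have key : ∀ {w : Fin 2 → ℕ} {c : ℕ}, (∀ k, s (k + 1) - s k ∈ weightIdeal K w (c + k)) →
      ∀ k j, s (k + j) - s k ∈ weightIdeal K w (c + k) := by
    intro w c h k j
    induction j with
    | zero => simp
    | succ j ih =>
      have := add_mem (weightIdeal_mono (by omega) (h (k + j))) ih
      simpa [add_assoc] using this
  -- The coefficient at `e` no longer changes once the index exceeds its weight, so any such stage
  -- gives the limit.
  let l : Series K := fun e => coeff e (s (expWeight w₁ e + expWeight w₂ e + 1))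
  have hl : ∀ e, coeff e l = coeff e (s (expWeight w₁ e + expWeight w₂ e + 1)) := fun e => rfl
  refine ⟨l, ?_, ?_⟩
  all_goals
    intro k e he
    by_contra hlt
    rw [not_le] at hlt
    apply he
    rw [map_sub, hl, sub_eq_zero]
    rcases le_total k (expWeight w₁ e + expWeight w₂ e + 1) with hk | hk
    · obtain ⟨j, hj⟩ := Nat.exists_eq_add_of_le hk
      rw [hj]
      first
        | exact coeff_eq_of_sub_mem (key h₁ k j) hlt
        | exact coeff_eq_of_sub_mem (key h₂ k j) hlt
    · obtain ⟨j, hj⟩ := Nat.exists_eq_add_of_le hk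
      rw [hj]
      exact (coeff_eq_of_sub_mem (w := w₁) (key h₁ _ j) (by omega)).symm

/-- An additive map that is the identity modulo higher weight is bijective. -/
lemma bijective_of_sub_mem {F : Type*} [FunLike F (Series K) (Series K)]
    [AddMonoidHomClass F (Series K) (Series K)] (φ : F)
    (hφ : ∀ n, ∀ g ∈ weightIdeal K w n, φ g - g ∈ weightIdeal K w (n + 1)) :
    Function.Bijective φ := by
  constructor
  · rw [injective_iff_map_eq_zero]
    intro g hg
    refine eq_zero_of_forall_mem (w := w) fun n => ?_
    induction n with
    | zero => exact fun e _ => Nat.zero_le _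
    | succ n ih =>
      have := hφ n g ih
      rwa [hg, zero_sub, neg_mem_iff] at this
  · intro t
    -- Adding the residual `r = t - φ g` to `g` turns the residual into `r - φ r`, which has gained
    -- one degree.
    let s : ℕ → Series K := fun n => Nat.rec 0 (fun _ g => g + (t - φ g)) n
    have hs : ∀ n, s (n + 1) = s n + (t - φ (s n)) := fun n => rfl
    have hr : ∀ n, t - φ (s n) ∈ weightIdeal K w n := by
      intro n
      induction n with
      | zero => exact fun e _ => Nat.zero_le _
      | succ n ih =>
        have := neg_mem (hφ n _ ih)
        rw [hs, map_add]
        convert this using 1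
        ring
    have hd : ∀ k, s (k + 1) - s k ∈ weightIdeal K w (0 + k) := by
      intro k
      rw [hs, add_sub_cancel_left, zero_add]
      exact hr k
    obtain ⟨l, hl, -⟩ := exists_limit hd hd
    refine ⟨l, ?_⟩
    rw [← sub_eq_zero]
    refine eq_zero_of_forall_mem (w := w) fun n => ?_
    have h1 := hl n
    rw [zero_add] at h1
    have h2 := weightIdeal_mono (Nat.le_succ n) (hφ n _ h1)
    have h3 := sub_mem (add_mem h2 h1) (hr n)
    rw [map_sub] at h3
    convert h3 using 1
    ring

/-- `p` has weighted order at least `m`, with the same leading form as `p₀`. -/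
def SameLeading (w : Fin 2 → ℕ) (m : ℕ) (p₀ p : Series K) : Prop :=
  p₀ ∈ weightIdeal K w m ∧ p - p₀ ∈ weightIdeal K w (m + 1)

lemma SameLeading.mem {p₀ p : Series K} (h : SameLeading w m p₀ p) : p ∈ weightIdeal K w m := by
  simpa using add_mem (weightIdeal_mono (Nat.le_succ m) h.2) h.1

lemma SameLeading.mono {p₀ p : Series K} (h : SameLeading w n p₀ p) (hmn : m ≤ n) :
    SameLeading w m p₀ p :=
  ⟨weightIdeal_mono hmn h.1, weightIdeal_mono (by omega) h.2⟩

lemma SameLeading.refl {p : Series K} (h : p ∈ weightIdeal K w m) : SameLeading w m p p :=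
  ⟨h, by simp⟩

lemma SameLeading.add {p₀ p q₀ q : Series K} (hp : SameLeading w m p₀ p)
    (hq : SameLeading w m q₀ q) : SameLeading w m (p₀ + q₀) (p + q) :=
  ⟨add_mem hp.1 hq.1, by rw [add_sub_add_comm]; exact add_mem hp.2 hq.2⟩

lemma SameLeading.mul {p₀ p q₀ q : Series K} (hp : SameLeading w m p₀ p)
    (hq : SameLeading w n q₀ q) : SameLeading w (m + n) (p₀ * q₀) (p * q) := by
  refine ⟨mul_mem_weightIdeal hp.1 hq.1, ?_⟩
  have h1 := weightIdeal_mono (n := m + 1 + n) (m := m + n + 1) (by omega)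
    (mul_mem_weightIdeal hp.2 hq.mem)
  have h2 := weightIdeal_mono (n := m + (n + 1)) (m := m + n + 1) (by omega)
    (mul_mem_weightIdeal hp.1 hq.2)
  convert add_mem h1 h2 using 1
  ring

lemma SameLeading.pow {p₀ p : Series K} (hp : SameLeading w m p₀ p) (i : ℕ) :
    SameLeading w (i * m) (p₀ ^ i) (p ^ i) := by
  induction i with
  | zero => simpa using SameLeading.refl (fun e _ => Nat.zero_le _)
  | succ i ih =>
    rw [pow_succ, pow_succ, Nat.succ_mul]
    exact ih.mul hp

/-- Passing from `p` to `p'` adds `L p₀` up to terms of weight greater than `m + k`. -/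
structure FirstOrder (w : Fin 2 → ℕ) (L : Derivation K (Series K) (Series K)) (k m : ℕ)
    (p₀ p p' : Series K) : Prop where
  lead : SameLeading w m p₀ p
  deriv_mem : L p₀ ∈ weightIdeal K w (m + k)
  approx : p' - p - L p₀ ∈ weightIdeal K w (m + k + 1)

namespace FirstOrder

variable {L : Derivation K (Series K) (Series K)} {p₀ p p' q₀ q q' : Series K}

lemma mono (h : FirstOrder w L k n p₀ p p') (hmn : m ≤ n) : FirstOrder w L k m p₀ p p' :=
  ⟨h.lead.mono hmn, weightIdeal_mono (by omega) h.deriv_mem,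
    weightIdeal_mono (by omega) h.approx⟩

lemma add (hp : FirstOrder w L k m p₀ p p') (hq : FirstOrder w L k m q₀ q q') :
    FirstOrder w L k m (p₀ + q₀) (p + q) (p' + q') := by
  refine ⟨hp.lead.add hq.lead, ?_, ?_⟩
  · rw [map_add]; exact add_mem hp.deriv_mem hq.deriv_mem
  · convert add_mem hp.approx hq.approx using 1
    rw [map_add]; ring

lemma sub_mem (h : FirstOrder w L k m p₀ p p') : p' - p ∈ weightIdeal K w (m + k) := by
  simpa using add_mem (weightIdeal_mono (Nat.le_succ _) h.approx) h.deriv_mem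

/-- Product rule: the error is `(p' - p - L p₀) q' + L p₀ (q' - q₀) + p (q' - q - L q₀) + (p - p₀) L
q₀`, and each summand gains one degree over `m + n + k`. The second one needs `k ≥ 1`, so that `q'`
still has leading form `q₀`. -/
lemma mul (hk : 1 ≤ k) (hp : FirstOrder w L k m p₀ p p') (hq : FirstOrder w L k n q₀ q q') :
    FirstOrder w L k (m + n) (p₀ * q₀) (p * q) (p' * q') := by
  have hq0 : q' - q₀ ∈ weightIdeal K w (n + 1) := by
    simpa using add_mem (weightIdeal_mono (by omega) hq.sub_mem) hq.lead.2
  have hq' : q' ∈ weightIdeal K w n := by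
    simpa using add_mem (weightIdeal_mono (Nat.le_succ n) hq0) hq.lead.1
  refine ⟨hp.lead.mul hq.lead, ?_, ?_⟩
  · rw [Derivation.leibniz, smul_eq_mul, smul_eq_mul]
    exact add_mem
      (weightIdeal_mono (by omega) (mul_mem_weightIdeal hp.lead.1 hq.deriv_mem))
      (weightIdeal_mono (by omega) (mul_mem_weightIdeal hq.lead.1 hp.deriv_mem))
  · have h1 := weightIdeal_mono (m := m + n + k + 1) (by omega)
      (mul_mem_weightIdeal hp.approx hq')
    have h2 := weightIdeal_mono (m := m + n + k + 1) (by omega)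
      (mul_mem_weightIdeal hp.deriv_mem hq0)
    have h3 := weightIdeal_mono (m := m + n + k + 1) (by omega)
      (mul_mem_weightIdeal hp.lead.mem hq.approx)
    have h4 := weightIdeal_mono (m := m + n + k + 1) (by omega)
      (mul_mem_weightIdeal hp.lead.2 hq.deriv_mem)
    convert add_mem (add_mem h1 h2) (add_mem h3 h4) using 1
    rw [Derivation.leibniz, smul_eq_mul, smul_eq_mul]
    ring

lemma const (r : K) : FirstOrder w L k 0 (C r) (C r) (C r) := by
  have h : L (C r) = 0 := L.map_algebraMap r
  exact ⟨SameLeading.refl fun e _ => Nat.zero_le _, by simp [h], by simp [h]⟩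

lemma pow (hk : 1 ≤ k) (hp : FirstOrder w L k m p₀ p p') (i : ℕ) :
    FirstOrder w L k (i * m) (p₀ ^ i) (p ^ i) (p' ^ i) := by
  induction i with
  | zero => simpa using const (w := w) (L := L) (k := k) 1
  | succ i ih =>
    rw [pow_succ, pow_succ, pow_succ, Nat.succ_mul]
    exact ih.mul hk hp

end FirstOrder

/-- The substitution `x ↦ x + u`, `y ↦ y + v` is an automorphism if it is the identity modulo
higher weight. -/
lemma exists_algEquiv {u v : Series K} (hu : u ∈ weightIdeal K w (w 0 + 1))
    (hv : v ∈ weightIdeal K w (w 1 + 1)) :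
    ∃ φ : Series K ≃ₐ[K] Series K, φ (X 0) = X 0 + u ∧ φ (X 1) = X 1 + v := by
  have hconst : ∀ {g : Series K} {c : ℕ}, g ∈ weightIdeal K w (c + 1) →
      constantCoeff g = 0 := by
    intro g c hg
    by_contra h0
    exact absurd (hg 0 (by simpa using h0)) (by simp [expWeight])
  let s : Fin 2 → Series K := ![X 0 + u, X 1 + v]
  have hs : HasSubst s := by
    refine hasSubst_of_constantCoeff_zero fun i => ?_
    fin_cases i
    · simp [s, hconst hu]
    · simp [s, hconst hv]
  have hmon : ∀ d : Fin 2 →₀ ℕ, d.prod (fun i e => s i ^ e) - monomial d 1 ∈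
      weightIdeal K w (expWeight w d + 1) := by
    intro d
    have h0 : SameLeading w (w 0) (X 0) (X 0 + u) := ⟨X_mem_weightIdeal 0, by simpa using hu⟩
    have h1 : SameLeading w (w 1) (X 1) (X 1 + v) := ⟨X_mem_weightIdeal 1, by simpa using hv⟩
    have := ((h0.pow (d 0)).mul (h1.pow (d 1))).2
    rw [monomial_eq', map_one, one_mul, Finsupp.prod_fintype _ _ (by simp),
      Finsupp.prod_fintype _ _ (by simp), Fin.prod_univ_two, Fin.prod_univ_two]
    exact this
  have key : ∀ n, ∀ g ∈ weightIdeal K w n,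
      (substAlgHom (R := K) hs) g - g ∈ weightIdeal K w (n + 1) := by
    classical
    intro n g hg e he
    by_contra hlt
    apply he
    -- Only exponents `d` of weight at least `n` occur in `g`, and at weight at most `n` their
    -- images agree with the monomials themselves.
    have hc : ∀ d, coeff d g • coeff e (d.prod fun i e => s i ^ e) =
        coeff d g • coeff e (monomial d (1 : K)) := by
      intro d
      by_cases hd : coeff d g = 0
      · simp [hd]
      · rw [coeff_eq_of_sub_mem (hmon d) (by have := hg d hd; omega)]
    rw [map_sub, substAlgHom_apply, coeff_subst hs, finsum_congr hc, finsum_eq_single _ e]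
    · simp
    · intro d hd
      rw [coeff_monomial_ne hd.symm, smul_zero]
  refine ⟨AlgEquiv.ofBijective (substAlgHom hs) (bijective_of_sub_mem (w := w) _ key), ?_, ?_⟩
  · exact substAlgHom_X hs 0
  · exact substAlgHom_X hs 1

end

/-! ### The two edge weights and the Newton filtration. -/

section

variable {K : Type*} [Field K] {w : Fin 2 → ℕ} {n k p q : ℕ}

lemma X_pow_mul_X_pow_mem {i j : ℕ} (h : n ≤ i * w 0 + j * w 1) :
    (X 0 ^ i * X 1 ^ j : Series K) ∈ weightIdeal K w n := by
  have h0 := (SameLeading.refl (X_mem_weightIdeal (K := K) (w := w) 0)).pow i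
  have h1 := (SameLeading.refl (X_mem_weightIdeal (K := K) (w := w) 1)).pow j
  exact weightIdeal_mono h (mul_mem_weightIdeal h0.1 h1.1)

lemma mem_of_C_mul_mem {I : Ideal (Series K)} {r : K} (hr : r ≠ 0) {g : Series K}
    (h : C r * g ∈ I) : g ∈ I := by
  have := I.mul_mem_left (C r⁻¹) h
  rwa [← mul_assoc, ← map_mul, inv_mul_cancel₀ hr, map_one, one_mul] at this

lemma pderiv_zero_cuspForm (p b : ℕ) (c : K) :
    pderiv K 0 (cuspForm (p + 2) b c) =
      C ((p + 2 : ℕ) : K) * X 0 ^ (p + 1) + C (2 * c) * (X 0 * X 1 ^ 2) := by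
  have h10 : pderiv K 0 (X 1 : Series K) = 0 := pderiv_X_of_ne (by decide)
  simp only [cuspForm, map_add, Derivation.leibniz, Derivation.leibniz_pow, pderiv_C, h10,
    pderiv_X_self, map_mul, map_natCast, smul_eq_mul, nsmul_eq_mul, smul_zero, mul_zero]
  have : (C (2 : K) : Series K) = 2 := map_ofNat C 2
  rw [this, show p + 2 - 1 = p + 1 from rfl]
  push_cast
  ring

lemma pderiv_one_cuspForm (a q : ℕ) (c : K) :
    pderiv K 1 (cuspForm a (q + 2) c) =
      C ((q + 2 : ℕ) : K) * X 1 ^ (q + 1) + C (2 * c) * (X 0 ^ 2 * X 1) := by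
  have h10 : pderiv K 1 (X 0 : Series K) = 0 := pderiv_X_of_ne (by decide)
  simp only [cuspForm, map_add, Derivation.leibniz, Derivation.leibniz_pow, pderiv_C, h10,
    pderiv_X_self, map_mul, map_natCast, smul_eq_mul, nsmul_eq_mul, smul_zero, mul_zero]
  have : (C (2 : K) : Series K) = 2 := map_ofNat C 2
  rw [this, show q + 2 - 1 = q + 1 from rfl]
  push_cast
  ring

/-- The weight that is constant on the edge of `Γ(x ^ (p + 2) + x² y² + y ^ (q + 2))` ending on
the first axis, with value `2 (p + 2) (q + 2)`. -/
def leftWeight (p q : ℕ) : Fin 2 → ℕ := ![2 * (q + 2), p * (q + 2)]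

/-- The weight that is constant on the edge of `Γ(x ^ (p + 2) + x² y² + y ^ (q + 2))` ending on
the second axis, with value `2 (p + 2) (q + 2)`. -/
def rightWeight (p q : ℕ) : Fin 2 → ℕ := ![q * (p + 2), 2 * (p + 2)]

/-- Series all of whose exponents have Newton weight at least `n`. -/
def newtonIdeal (K : Type*) [Field K] (p q n : ℕ) : Ideal (Series K) :=
  weightIdeal K (leftWeight p q) n ⊓ weightIdeal K (rightWeight p q) n

/-- Coefficients of `∂/∂x_s` in vector fields raising the Newton weight by at least `k`. -/
def fieldIdeal (K : Type*) [Field K] (p q : ℕ) (s : Fin 2) (k : ℕ) : Ideal (Series K) :=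
  weightIdeal K (leftWeight p q) (leftWeight p q s + k) ⊓
    weightIdeal K (rightWeight p q) (rightWeight p q s + k)

/-- The image of the form under vector fields raising the Newton weight by `k`, together with
all terms of larger weight. -/
def tangentIdeal (p q : ℕ) (c : K) (k : ℕ) : Ideal (Series K) :=
  fieldIdeal K p q 0 k * Ideal.span {pderiv K 0 (cuspForm (p + 2) (q + 2) c)} ⊔
    fieldIdeal K p q 1 k * Ideal.span {pderiv K 1 (cuspForm (p + 2) (q + 2) c)} ⊔
    newtonIdeal K p q (2 * (p + 2) * (q + 2) + k + 1)

lemma mem_newtonIdeal_of_le {i j : ℕ}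
    (h₁ : n ≤ i * (2 * (q + 2)) + j * (p * (q + 2)))
    (h₂ : n ≤ i * (q * (p + 2)) + j * (2 * (p + 2))) :
    (X 0 ^ i * X 1 ^ j : Series K) ∈ newtonIdeal K p q n :=
  ⟨X_pow_mul_X_pow_mem h₁, X_pow_mul_X_pow_mem h₂⟩

/-! ### Solving the infinitesimal equation on monomials. -/

variable {c : K}

lemma mul_pderiv_zero_mem {g : Series K} (hg : g ∈ fieldIdeal K p q 0 k) :
    g * pderiv K 0 (cuspForm (p + 2) (q + 2) c) ∈ tangentIdeal p q c k :=
  Ideal.mem_sup_left (Ideal.mem_sup_left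
    (Ideal.mul_mem_mul hg (Ideal.mem_span_singleton_self _)))

lemma mul_pderiv_one_mem {g : Series K} (hg : g ∈ fieldIdeal K p q 1 k) :
    g * pderiv K 1 (cuspForm (p + 2) (q + 2) c) ∈ tangentIdeal p q c k :=
  Ideal.mem_sup_left (Ideal.mem_sup_right
    (Ideal.mul_mem_mul hg (Ideal.mem_span_singleton_self _)))

lemma mem_tangentIdeal_of_mem_newtonIdeal {g : Series K}
    (hg : g ∈ newtonIdeal K p q (2 * (p + 2) * (q + 2) + k + 1)) : g ∈ tangentIdeal p q c k :=
  Ideal.mem_sup_right hg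

/-- Uses `2c x²y = ∂f₀/∂y - (q + 2) y ^ (q + 1)`, multiplied by `x ^ i y ^ j`. This multiplier is an
admissible coefficient of `∂/∂y` because `x²y²`, the common vertex of the edges, has both weights
equal to `d`. The replacement keeps the right weight and raises the left one by `(q + 2) (p q - 4)`.
-/
lemma tangent_step_one (hc : 2 * c ≠ 0) {i j : ℕ}
    (h₁ : 2 * (p + 2) * (q + 2) + k ≤ (i + 2) * (2 * (q + 2)) + (j + 1) * (p * (q + 2)))
    (h₂ : 2 * (p + 2) * (q + 2) + k ≤ (i + 2) * (q * (p + 2)) + (j + 1) * (2 * (p + 2)))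
    (h : (X 0 ^ i * X 1 ^ (j + q + 1) : Series K) ∈ tangentIdeal p q c k) :
    (X 0 ^ (i + 2) * X 1 ^ (j + 1) : Series K) ∈ tangentIdeal p q c k := by
  refine mem_of_C_mul_mem hc ?_
  have hf : (X 0 ^ i * X 1 ^ j : Series K) ∈ fieldIdeal K p q 1 k := by
    refine ⟨X_pow_mul_X_pow_mem ?_, X_pow_mul_X_pow_mem ?_⟩
    · simp only [leftWeight, Matrix.cons_val_zero, Matrix.cons_val_one]; nlinarith
    · simp only [rightWeight, Matrix.cons_val_zero, Matrix.cons_val_one]; nlinarith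
  have := sub_mem (mul_pderiv_one_mem (c := c) hf)
    (Ideal.mul_mem_left _ (C ((q + 2 : ℕ) : K)) h)
  rw [pderiv_one_cuspForm] at this
  convert this using 1
  ring

/-- The mirror image, from `2c xy² = ∂f₀/∂x - (p + 2) x ^ (p + 1)`: the left weight is kept and the
right one grows by `(p + 2) (p q - 4)`. -/
lemma tangent_step_zero (hc : 2 * c ≠ 0) {i j : ℕ}
    (h₁ : 2 * (p + 2) * (q + 2) + k ≤ (i + 1) * (2 * (q + 2)) + (j + 2) * (p * (q + 2)))
    (h₂ : 2 * (p + 2) * (q + 2) + k ≤ (i + 1) * (q * (p + 2)) + (j + 2) * (2 * (p + 2)))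
    (h : (X 0 ^ (i + p + 1) * X 1 ^ j : Series K) ∈ tangentIdeal p q c k) :
    (X 0 ^ (i + 1) * X 1 ^ (j + 2) : Series K) ∈ tangentIdeal p q c k := by
  refine mem_of_C_mul_mem hc ?_
  have hf : (X 0 ^ i * X 1 ^ j : Series K) ∈ fieldIdeal K p q 0 k := by
    refine ⟨X_pow_mul_X_pow_mem ?_, X_pow_mul_X_pow_mem ?_⟩
    · simp only [leftWeight, Matrix.cons_val_zero, Matrix.cons_val_one]; nlinarith
    · simp only [rightWeight, Matrix.cons_val_zero, Matrix.cons_val_one]; nlinarith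
  have := sub_mem (mul_pderiv_zero_mem (c := c) hf)
    (Ideal.mul_mem_left _ (C ((p + 2 : ℕ) : K)) h)
  rw [pderiv_zero_cuspForm] at this
  convert this using 1
  ring

/-- Below the diagonal the right weight already exceeds the left one, hence is at least `d + k + 1`.
Only the left weight has to grow, and one replacement achieves that. -/
lemma tangent_of_gt (hc : 2 * c ≠ 0) (hpq : 4 < p * q) {i j : ℕ} (hij : j < i) (hj : 1 ≤ j)
    (h₁ : 2 * (p + 2) * (q + 2) + k ≤ i * (2 * (q + 2)) + j * (p * (q + 2)))
    (h₂ : 2 * (p + 2) * (q + 2) + k ≤ i * (q * (p + 2)) + j * (2 * (p + 2))) :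
    (X 0 ^ i * X 1 ^ j : Series K) ∈ tangentIdeal p q c k := by
  obtain ⟨i, rfl⟩ : ∃ i', i = i' + 2 := ⟨i - 2, by omega⟩
  obtain ⟨j, rfl⟩ : ∃ j', j = j' + 1 := ⟨j - 1, by omega⟩
  refine tangent_step_one hc h₁ h₂ (mem_tangentIdeal_of_mem_newtonIdeal
    (mem_newtonIdeal_of_le ?_ ?_))
  · nlinarith [Nat.mul_le_mul_right q hpq]
  · nlinarith [Nat.mul_le_mul (show j + 1 ≤ i + 1 by omega) hpq.le,
      Nat.mul_le_mul (show j ≤ i by omega) hpq.le, Nat.mul_le_mul_left (i - j) hpq.le]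

lemma tangent_of_lt (hc : 2 * c ≠ 0) (hpq : 4 < p * q) {i j : ℕ} (hij : i < j) (hi : 1 ≤ i)
    (h₁ : 2 * (p + 2) * (q + 2) + k ≤ i * (2 * (q + 2)) + j * (p * (q + 2)))
    (h₂ : 2 * (p + 2) * (q + 2) + k ≤ i * (q * (p + 2)) + j * (2 * (p + 2))) :
    (X 0 ^ i * X 1 ^ j : Series K) ∈ tangentIdeal p q c k := by
  obtain ⟨i, rfl⟩ : ∃ i', i = i' + 1 := ⟨i - 1, by omega⟩
  obtain ⟨j, rfl⟩ : ∃ j', j = j' + 2 := ⟨j - 2, by omega⟩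
  refine tangent_step_zero hc h₁ h₂ (mem_tangentIdeal_of_mem_newtonIdeal
    (mem_newtonIdeal_of_le ?_ ?_))
  · nlinarith [Nat.mul_le_mul_right q hpq]
  · nlinarith [Nat.mul_le_mul_right q hpq]

/-- On the diagonal both weights are `i (p + 2) (q + 2)`, so a single replacement leaves the right
weight possibly equal to `d + k`. It does move the monomial above the diagonal, where the other
replacement finishes. This needs `i ≥ 3`, so that a factor `x` survives; `k ≥ 1` guarantees it by
excluding `x²y²`. -/
lemma tangent_of_eq (hc : 2 * c ≠ 0) (hpq : 4 < p * q) (hk : 1 ≤ k) {i : ℕ}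
    (h₁ : 2 * (p + 2) * (q + 2) + k ≤ i * (2 * (q + 2)) + i * (p * (q + 2)))
    (h₂ : 2 * (p + 2) * (q + 2) + k ≤ i * (q * (p + 2)) + i * (2 * (p + 2))) :
    (X 0 ^ i * X 1 ^ i : Series K) ∈ tangentIdeal p q c k := by
  have hi : 2 < i := by
    by_contra hi
    have := Nat.mul_le_mul_right ((p + 2) * (q + 2)) (not_lt.1 hi)
    nlinarith
  obtain ⟨i, rfl⟩ : ∃ i', i = i' + 3 := ⟨i - 3, by omega⟩
  refine tangent_step_one (i := i + 1) (j := i + 2) hc h₁ h₂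
    (tangent_of_lt hc hpq (by omega) (by omega) ?_ ?_)
  · nlinarith [Nat.mul_le_mul_right q hpq]
  · nlinarith [Nat.mul_le_mul_right q hpq]

/-- A pure power contains neither `x²y` nor `xy²`, so `∂f₀/∂x` is used backwards: `x ^ (p + 1)` is
traded for `xy²` at equal left weight, giving a mixed monomial below the diagonal. Characteristic
zero allows division by `p + 2`. -/
lemma tangent_X_zero_pow [CharZero K] (hc : 2 * c ≠ 0) (hpq : 4 < p * q) (hk : 1 ≤ k) {i : ℕ}
    (h₁ : 2 * (p + 2) * (q + 2) + k ≤ i * (2 * (q + 2))) :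
    (X 0 ^ i : Series K) ∈ tangentIdeal p q c k := by
  have hi : p + 2 < i := by
    by_contra hi
    have := Nat.mul_le_mul_right (2 * (q + 2)) (not_lt.1 hi)
    nlinarith
  obtain ⟨s, rfl⟩ : ∃ s, i = p + s + 3 := ⟨i - p - 3, by omega⟩
  have h₂ : (s + 1) * (2 * (q + 2)) ≤ (s + 1) * (q * (p + 2)) :=
    Nat.mul_le_mul_left _ (by nlinarith)
  have hf : (X 0 ^ (s + 2) * X 1 ^ 0 : Series K) ∈ fieldIdeal K p q 0 k := by
    refine ⟨X_pow_mul_X_pow_mem ?_, X_pow_mul_X_pow_mem ?_⟩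
    · simp only [leftWeight, Matrix.cons_val_zero, Matrix.cons_val_one]; nlinarith
    · simp only [rightWeight, Matrix.cons_val_zero, Matrix.cons_val_one]; nlinarith
  have hm : (X 0 ^ (s + 3) * X 1 ^ 2 : Series K) ∈ tangentIdeal p q c k :=
    tangent_of_gt hc hpq (by omega) (by omega) (by nlinarith) (by nlinarith)
  have hp : ((p + 2 : ℕ) : K) ≠ 0 := Nat.cast_ne_zero.2 (by omega)
  refine mem_of_C_mul_mem hp ?_
  have := sub_mem (mul_pderiv_zero_mem (c := c) hf) (Ideal.mul_mem_left _ (C (2 * c)) hm)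
  rw [pderiv_zero_cuspForm] at this
  convert this using 1
  ring

lemma tangent_X_one_pow [CharZero K] (hc : 2 * c ≠ 0) (hpq : 4 < p * q) (hk : 1 ≤ k) {j : ℕ}
    (h₂ : 2 * (p + 2) * (q + 2) + k ≤ j * (2 * (p + 2))) :
    (X 1 ^ j : Series K) ∈ tangentIdeal p q c k := by
  have hj : q + 2 < j := by
    by_contra hj
    have := Nat.mul_le_mul_right (2 * (p + 2)) (not_lt.1 hj)
    nlinarith
  obtain ⟨s, rfl⟩ : ∃ s, j = q + s + 3 := ⟨j - q - 3, by omega⟩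
  have h₁ : (s + 1) * (2 * (p + 2)) ≤ (s + 1) * (p * (q + 2)) :=
    Nat.mul_le_mul_left _ (by nlinarith)
  have hf : (X 0 ^ 0 * X 1 ^ (s + 2) : Series K) ∈ fieldIdeal K p q 1 k := by
    refine ⟨X_pow_mul_X_pow_mem ?_, X_pow_mul_X_pow_mem ?_⟩
    · simp only [leftWeight, Matrix.cons_val_zero, Matrix.cons_val_one]; nlinarith
    · simp only [rightWeight, Matrix.cons_val_zero, Matrix.cons_val_one]; nlinarith
  have hm : (X 0 ^ 2 * X 1 ^ (s + 3) : Series K) ∈ tangentIdeal p q c k :=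
    tangent_of_lt hc hpq (by omega) (by omega) (by nlinarith) (by nlinarith)
  have hq : ((q + 2 : ℕ) : K) ≠ 0 := Nat.cast_ne_zero.2 (by omega)
  refine mem_of_C_mul_mem hq ?_
  have := sub_mem (mul_pderiv_one_mem (c := c) hf) (Ideal.mul_mem_left _ (C (2 * c)) hm)
  rw [pderiv_one_cuspForm] at this
  convert this using 1
  ring

lemma X_pow_mem_tangentIdeal [CharZero K] (hc : 2 * c ≠ 0) (hpq : 4 < p * q) (hk : 1 ≤ k)
    {i j : ℕ}
    (h₁ : 2 * (p + 2) * (q + 2) + k ≤ i * (2 * (q + 2)) + j * (p * (q + 2)))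
    (h₂ : 2 * (p + 2) * (q + 2) + k ≤ i * (q * (p + 2)) + j * (2 * (p + 2))) :
    (X 0 ^ i * X 1 ^ j : Series K) ∈ tangentIdeal p q c k := by
  rcases Nat.eq_zero_or_pos i with rfl | hi
  · simpa using tangent_X_one_pow hc hpq hk (by simpa using h₂)
  rcases Nat.eq_zero_or_pos j with rfl | hj
  · simpa using tangent_X_zero_pow hc hpq hk (by simpa using h₁)
  rcases lt_trichotomy i j with h | rfl | h
  · exact tangent_of_lt hc hpq h hi h₁ h₂
  · exact tangent_of_eq hc hpq hk h₁ h₂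
  · exact tangent_of_gt hc hpq h hj h₁ h₂

/-- The monomial case passes only to finite sums, so the series is truncated to a box. Both weights
of each variable are at least `1`, so terms outside the box have Newton weight at least `n + 1` and
are absorbed. -/
lemma newtonIdeal_le_tangentIdeal [CharZero K] (hc : 2 * c ≠ 0) (hpq : 4 < p * q) (hk : 1 ≤ k) :
    newtonIdeal K p q (2 * (p + 2) * (q + 2) + k) ≤ tangentIdeal p q c k := by
  classical
  rintro h ⟨h₁, h₂⟩
  have hp : 1 ≤ p := Nat.pos_of_ne_zero (by rintro rfl; simp at hpq)
  have hq : 1 ≤ q := Nat.pos_of_ne_zero (by rintro rfl; simp at hpq)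
  set n := 2 * (p + 2) * (q + 2) + k with hn
  let N : Fin 2 →₀ ℕ := Finsupp.equivFunOnFinite.symm fun _ => n
  let P : Series K := ∑ e ∈ Finset.Icc 0 N, monomial e (coeff e h)
  have hP : P ∈ tangentIdeal p q c k := by
    refine sum_mem fun e _ => ?_
    by_cases he : coeff e h = 0
    · simp [he]
    have hm : monomial e (coeff e h) = C (coeff e h) * (X 0 ^ e 0 * X 1 ^ e 1) := by
      rw [monomial_eq', Finsupp.prod_fintype _ _ (by simp), Fin.prod_univ_two]
    rw [hm]
    exact Ideal.mul_mem_left _ _ (X_pow_mem_tangentIdeal hc hpq hk (h₁ e he) (h₂ e he))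
  have hcoeff : ∀ e, coeff e (h - P) ≠ 0 → n + 1 ≤ e 0 ∨ n + 1 ≤ e 1 := by
    intro e he
    by_contra hlt
    push Not at hlt
    have heN : e ∈ Finset.Icc 0 N := by
      rw [Finset.mem_Icc]
      refine ⟨zero_le, fun s => ?_⟩
      fin_cases s
      · exact Nat.lt_succ_iff.1 hlt.1
      · exact Nat.lt_succ_iff.1 hlt.2
    apply he
    simp only [P, map_sub, map_sum, coeff_monomial]
    rw [Finset.sum_ite_eq, if_pos heN, sub_self]
  have hR : h - P ∈ newtonIdeal K p q (n + 1) := by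
    constructor
    · intro e he
      simp only [expWeight, leftWeight, Matrix.cons_val_zero, Matrix.cons_val_one]
      rcases hcoeff e he with h | h
      · exact (h.trans (Nat.le_mul_of_pos_right _ (by positivity))).trans (Nat.le_add_right _ _)
      · exact (h.trans (Nat.le_mul_of_pos_right _ (by positivity))).trans (Nat.le_add_left _ _)
    · intro e he
      simp only [expWeight, rightWeight, Matrix.cons_val_zero, Matrix.cons_val_one]
      rcases hcoeff e he with h | h
      · exact (h.trans (Nat.le_mul_of_pos_right _ (by positivity))).trans (Nat.le_add_right _ _)
      · exact (h.trans (Nat.le_mul_of_pos_right _ (by positivity))).trans (Nat.le_add_left _ _)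
  simpa using add_mem (mem_tangentIdeal_of_mem_newtonIdeal hR) hP

lemma exists_field [CharZero K] (hc : 2 * c ≠ 0) (hpq : 4 < p * q) (hk : 1 ≤ k) {h : Series K}
    (hh : h ∈ newtonIdeal K p q (2 * (p + 2) * (q + 2) + k)) :
    ∃ u ∈ fieldIdeal K p q 0 k, ∃ v ∈ fieldIdeal K p q 1 k,
      h - (u * pderiv K 0 (cuspForm (p + 2) (q + 2) c) +
        v * pderiv K 1 (cuspForm (p + 2) (q + 2) c)) ∈
        newtonIdeal K p q (2 * (p + 2) * (q + 2) + k + 1) := by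
  obtain ⟨g, hg, r, hr, rfl⟩ :=
    Submodule.mem_sup.1 (newtonIdeal_le_tangentIdeal (c := c) hc hpq hk hh)
  obtain ⟨g₁, hg₁, g₂, hg₂, rfl⟩ := Submodule.mem_sup.1 hg
  obtain ⟨u, hu, rfl⟩ := Ideal.mem_mul_span_singleton.1 hg₁
  obtain ⟨v, hv, rfl⟩ := Ideal.mem_mul_span_singleton.1 hg₂
  exact ⟨u, hu, v, hv, by simpa using hr⟩

/-- The value of the form `x ^ a + c x² y² + y ^ b` at two series. -/
def cuspEval (a b : ℕ) (c : K) (s t : Series K) : Series K := s ^ a + C c * s ^ 2 * t ^ 2 + t ^ b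

/-- The linear term may be taken at `(x, y)` instead of `(x + u, y + v)`, since `u` and `v` alter
only non-leading terms. The inequalities allow a monomial of the form to lie strictly above the edge
of `w`. -/
lemma firstOrder_cuspEval {a b d : ℕ} (ha : d ≤ a * w 0) (hm : d ≤ 2 * w 0 + 2 * w 1)
    (hb : d ≤ b * w 1) (c : K) (hk : 1 ≤ k) {u v δ ε : Series K}
    (hu : u ∈ weightIdeal K w (w 0 + 1)) (hv : v ∈ weightIdeal K w (w 1 + 1))
    (hδ : δ ∈ weightIdeal K w (w 0 + k)) (hε : ε ∈ weightIdeal K w (w 1 + k)) :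
    FirstOrder w (δ • pderiv K 0 + ε • pderiv K 1) k d (cuspForm a b c)
      (cuspEval a b c (X 0 + u) (X 1 + v)) (cuspEval a b c (X 0 + u + δ) (X 1 + v + ε)) := by
  have h10 : pderiv K 1 (X 0 : Series K) = 0 := pderiv_X_of_ne (by decide)
  have h01 : pderiv K 0 (X 1 : Series K) = 0 := pderiv_X_of_ne (by decide)
  set L := δ • pderiv K (σ := Fin 2) 0 + ε • pderiv K 1 with hL
  have hx : FirstOrder w L k (w 0) (X 0) (X 0 + u) (X 0 + u + δ) :=
    ⟨⟨X_mem_weightIdeal 0, by simpa using hu⟩, by simpa [hL, h10] using hδ, by simp [hL, h10]⟩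
  have hy : FirstOrder w L k (w 1) (X 1) (X 1 + v) (X 1 + v + ε) :=
    ⟨⟨X_mem_weightIdeal 1, by simpa using hv⟩, by simpa [hL, h01] using hε, by simp [hL, h01]⟩
  have h1 := (hx.pow hk a).mono ha
  have h2 := (((FirstOrder.const c).mul hk (hx.pow hk 2)).mul hk (hy.pow hk 2)).mono
    (hm.trans (by rw [zero_add]))
  have h3 := (hy.pow hk b).mono hb
  exact (h1.add h2).add h3

lemma fieldIdeal_mono {s : Fin 2} {m : ℕ} (h : m ≤ n) :
    fieldIdeal K p q s n ≤ fieldIdeal K p q s m :=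
  inf_le_inf (weightIdeal_mono (by omega)) (weightIdeal_mono (by omega))

lemma cuspEval_sub_mem (c : K) (hpq : 4 < p * q) (hk : 1 ≤ k) {u v δ ε : Series K}
    (hu : u ∈ fieldIdeal K p q 0 1) (hv : v ∈ fieldIdeal K p q 1 1)
    (hδ : δ ∈ fieldIdeal K p q 0 k) (hε : ε ∈ fieldIdeal K p q 1 k) :
    cuspEval (p + 2) (q + 2) c (X 0 + u + δ) (X 1 + v + ε) -
      cuspEval (p + 2) (q + 2) c (X 0 + u) (X 1 + v) ∈
        newtonIdeal K p q (2 * (p + 2) * (q + 2) + k) ∧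
    cuspEval (p + 2) (q + 2) c (X 0 + u + δ) (X 1 + v + ε) -
      cuspEval (p + 2) (q + 2) c (X 0 + u) (X 1 + v) -
      (δ * pderiv K 0 (cuspForm (p + 2) (q + 2) c) +
        ε * pderiv K 1 (cuspForm (p + 2) (q + 2) c)) ∈
        newtonIdeal K p q (2 * (p + 2) * (q + 2) + k + 1) := by
  have h₁ := firstOrder_cuspEval (w := leftWeight p q) (a := p + 2) (b := q + 2)
    (d := 2 * (p + 2) * (q + 2))
    (by simp only [leftWeight, Matrix.cons_val_zero]; nlinarith)
    (by simp only [leftWeight, Matrix.cons_val_zero, Matrix.cons_val_one]; nlinarith)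
    (by simp only [leftWeight, Matrix.cons_val_zero, Matrix.cons_val_one]
        nlinarith [Nat.mul_le_mul_left q hpq])
    c hk hu.1 hv.1 hδ.1 hε.1
  have h₂ := firstOrder_cuspEval (w := rightWeight p q) (a := p + 2) (b := q + 2)
    (d := 2 * (p + 2) * (q + 2))
    (by simp only [rightWeight, Matrix.cons_val_zero]
        nlinarith [Nat.mul_le_mul_left p hpq])
    (by simp only [rightWeight, Matrix.cons_val_zero, Matrix.cons_val_one]; nlinarith)
    (by simp only [rightWeight, Matrix.cons_val_zero, Matrix.cons_val_one]; nlinarith)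
    c hk hu.2 hv.2 hδ.2 hε.2
  exact ⟨⟨h₁.sub_mem, h₂.sub_mem⟩, ⟨h₁.approx, h₂.approx⟩⟩

/-- Adding terms above the Newton polygon to `x ^ a + c x² y² + y ^ b` does not change its right
equivalence class. Finiteness of the Milnor number is automatic here, hence not assumed. -/
theorem rightEquivalent_of_sub_mem [CharZero K] (hc : c ≠ 0) (hpq : 4 < p * q) {f : Series K}
    (hf : f - cuspForm (p + 2) (q + 2) c ∈ newtonIdeal K p q (2 * (p + 2) * (q + 2) + 1)) :
    RightEquivalent f (cuspForm (p + 2) (q + 2) c) := by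
  have hc2 : 2 * c ≠ 0 := mul_ne_zero two_ne_zero hc
  let G : Series K × Series K → Series K :=
    fun s => cuspEval (p + 2) (q + 2) c (X 0 + s.1) (X 1 + s.2)
  let good : ℕ → Series K × Series K → Prop := fun n s =>
    s.1 ∈ fieldIdeal K p q 0 1 ∧ s.2 ∈ fieldIdeal K p q 1 1 ∧
      f - G s ∈ newtonIdeal K p q (2 * (p + 2) * (q + 2) + (n + 1))
  -- The hypothesis `good n s` stands inside the existential so that `choose` yields a total
  -- function to iterate.
  have step : ∀ n s, ∃ s', good n s → good (n + 1) s' ∧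
      s'.1 - s.1 ∈ fieldIdeal K p q 0 (n + 1) ∧ s'.2 - s.2 ∈ fieldIdeal K p q 1 (n + 1) := by
    intro n s
    by_cases hs : good n s
    swap
    · exact ⟨s, fun h => absurd h hs⟩
    obtain ⟨hu, hv, hG⟩ := hs
    obtain ⟨δ, hδ, ε, hε, hr⟩ := exists_field hc2 hpq (Nat.le_add_left 1 n) hG
    refine ⟨(s.1 + δ, s.2 + ε), fun _ => ⟨⟨add_mem hu (fieldIdeal_mono (by omega) hδ),
      add_mem hv (fieldIdeal_mono (by omega) hε), ?_⟩, by simpa using hδ, by simpa using hε⟩⟩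
    have h2 := (cuspEval_sub_mem c hpq (Nat.le_add_left 1 n) hu hv hδ hε).2
    have hG' : G (s.1 + δ, s.2 + ε) =
        cuspEval (p + 2) (q + 2) c (X 0 + s.1 + δ) (X 1 + s.2 + ε) := by
      simp only [G, add_assoc]
    rw [← hG', show cuspEval (p + 2) (q + 2) c (X 0 + s.1) (X 1 + s.2) = G s from rfl] at h2
    have h3 := sub_mem hr h2
    rwa [sub_sub_sub_cancel_right, sub_sub_sub_cancel_right] at h3
  choose nxt hnxt using step
  let s : ℕ → Series K × Series K := fun n => Nat.rec (0, 0) (fun n t => nxt n t) n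
  have hs : ∀ n, good n (s n) := by
    intro n
    induction n with
    | zero =>
      refine ⟨zero_mem _, zero_mem _, ?_⟩
      simpa [s, G, cuspEval, cuspForm] using hf
    | succ n ih => exact (hnxt n _ ih).1
  have hd : ∀ n, (s (n + 1)).1 - (s n).1 ∈ fieldIdeal K p q 0 (n + 1) ∧
      (s (n + 1)).2 - (s n).2 ∈ fieldIdeal K p q 1 (n + 1) := fun n => (hnxt n _ (hs n)).2
  have shift : ∀ c n : ℕ, c + (n + 1) = c + 1 + n := fun c n => by omega
  obtain ⟨u, hu₁, hu₂⟩ := exists_limit (s := fun n => (s n).1)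
    (fun n => shift (leftWeight p q 0) n ▸ (hd n).1.1)
    (fun n => shift (rightWeight p q 0) n ▸ (hd n).1.2)
  obtain ⟨v, hv₁, hv₂⟩ := exists_limit (s := fun n => (s n).2)
    (fun n => shift (leftWeight p q 1) n ▸ (hd n).2.1)
    (fun n => shift (rightWeight p q 1) n ▸ (hd n).2.2)
  have hu : ∀ n, u - (s n).1 ∈ fieldIdeal K p q 0 (n + 1) := fun n =>
    ⟨shift (leftWeight p q 0) n ▸ hu₁ n, shift (rightWeight p q 0) n ▸ hu₂ n⟩
  have hv : ∀ n, v - (s n).2 ∈ fieldIdeal K p q 1 (n + 1) := fun n =>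
    ⟨shift (leftWeight p q 1) n ▸ hv₁ n, shift (rightWeight p q 1) n ▸ hv₂ n⟩
  -- Both `f - G (s n)` and `G (u, v) - G (s n)` have Newton weight at least `d + n + 1`, for every
  -- `n`.
  have hfG : f = G (u, v) := by
    rw [← sub_eq_zero]
    refine eq_zero_of_forall_mem (w := leftWeight p q) fun n => ?_
    have h1 := (cuspEval_sub_mem c hpq (Nat.le_add_left 1 n) (hs n).1 (hs n).2.1 (hu n)
      (hv n)).1
    rw [add_assoc, add_assoc, add_sub_cancel, add_sub_cancel] at h1
    have h2 : f - G (u, v) ∈ newtonIdeal K p q (2 * (p + 2) * (q + 2) + (n + 1)) := by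
      have h3 := sub_mem (hs n).2.2 h1
      rwa [show cuspEval (p + 2) (q + 2) c (X 0 + (s n).1) (X 1 + (s n).2) = G (s n) from rfl,
        sub_sub_sub_cancel_right] at h3
    exact weightIdeal_mono (by omega) h2.1
  obtain ⟨φ, hφ0, hφ1⟩ := exists_algEquiv (w := leftWeight p q) (u := u) (v := v)
    (by have := (hu 0).1; rwa [show (s 0).1 = 0 from rfl, sub_zero] at this)
    (by have := (hv 0).1; rwa [show (s 0).2 = 0 from rfl, sub_zero] at this)
  refine ⟨φ.symm, ?_⟩
  rw [AlgEquiv.symm_apply_eq, hfG]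
  have hφc : φ (C c) = C c := φ.commutes c
  simp only [G, cuspEval, cuspForm, map_add, map_mul, map_pow, hφ0, hφ1, hφc]

end

/-! ### Convex geometry of Newton polyhedra. -/

section

variable {K : Type*} [Field K] {f : Series K}

lemma convex_halfPlane (u v c : ℝ) : Convex ℝ {z : ℝ × ℝ | c ≤ u * z.1 + v * z.2} := by
  intro y hy z hz s t hs ht hst
  simp only [Set.mem_ofPred_eq, Prod.fst_add, Prod.snd_add, Prod.smul_fst, Prod.smul_snd,
    smul_eq_mul] at *
  obtain rfl : s = 1 - t := by linarith
  nlinarith [mul_le_mul_of_nonneg_left hy hs, mul_le_mul_of_nonneg_left hz ht]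

lemma isClosed_halfPlane (u v c : ℝ) : IsClosed {z : ℝ × ℝ | c ≤ u * z.1 + v * z.2} :=
  isClosed_le continuous_const (by fun_prop)

lemma Ici_subset_newtonPolyhedron {e : Fin 2 →₀ ℕ} (he : coeff e f ≠ 0) :
    Set.Ici (expPoint e) ⊆ newtonPolyhedron f :=
  (Set.subset_biUnion_of_mem (u := fun e => Set.Ici (expPoint e)) he).trans
    (subset_convexHull ℝ _)

lemma newtonPolyhedron_subset {T : Set (ℝ × ℝ)} (hT : Convex ℝ T)
    (h : ∀ e, coeff e f ≠ 0 → Set.Ici (expPoint e) ⊆ T) : newtonPolyhedron f ⊆ T :=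
  convexHull_min (Set.iUnion₂_subset h) hT

lemma convex_newtonPolyhedron : Convex ℝ (newtonPolyhedron f) := convex_convexHull ℝ _

lemma newtonPolyhedron_subset_halfPlane {u v c : ℝ} (hu : 0 ≤ u) (hv : 0 ≤ v)
    (h : ∀ e : Fin 2 →₀ ℕ, coeff e f ≠ 0 → c ≤ u * e 0 + v * e 1) :
    newtonPolyhedron f ⊆ {z : ℝ × ℝ | c ≤ u * z.1 + v * z.2} := by
  refine newtonPolyhedron_subset (convex_halfPlane u v c) fun e he z hz => ?_
  have h1 := mul_le_mul_of_nonneg_left hz.1 hu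
  have h2 := mul_le_mul_of_nonneg_left hz.2 hv
  have h3 := h e he
  simp only [expPoint] at h1 h2
  simp only [Set.mem_ofPred_eq]
  linarith

/-- A point of a set on a supporting line is on the frontier. -/
lemma mem_frontier_of_halfPlane {P : Set (ℝ × ℝ)} {u v c : ℝ} (huv : 0 < u ^ 2 + v ^ 2)
    (hP : P ⊆ {z : ℝ × ℝ | c ≤ u * z.1 + v * z.2}) {z : ℝ × ℝ} (hz : z ∈ P)
    (heq : u * z.1 + v * z.2 = c) : z ∈ frontier P := by
  refine ⟨subset_closure hz, fun hint => ?_⟩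
  have hcont : Continuous fun t : ℝ => (z.1 - t * u, z.2 - t * v) := by fun_prop
  have hmem : (fun t : ℝ => (z.1 - t * u, z.2 - t * v)) ⁻¹' interior P ∈ nhds (0 : ℝ) :=
    (isOpen_interior.preimage hcont).mem_nhds (by simpa using hint)
  obtain ⟨ε, hε, hball⟩ := Metric.mem_nhds_iff.1 hmem
  have h1 : ε / 2 ∈ Metric.ball (0 : ℝ) ε := by
    rw [Metric.mem_ball, Real.dist_eq, sub_zero, abs_of_pos (by linarith)]; linarith
  have h2 := hP (interior_subset (hball h1))
  simp only [Set.mem_ofPred_eq] at h2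
  nlinarith

/-- Otherwise the segment prolonged to double length would contradict maximality. -/
lemma right_notMem_of_face {P : Set (ℝ × ℝ)} {y z : ℝ × ℝ} (hyz : y ≠ z)
    (hmax : Maximal (fun S : Set (ℝ × ℝ) => S ⊆ P ∧ ∃ y z, y ≠ z ∧ S = segment ℝ y z)
      (segment ℝ y z)) : ¬ segment ℝ y (z + (z - y)) ⊆ P := by
  intro hsub
  have hne : y ≠ z + (z - y) := by
    intro h
    apply hyz
    have h1 := congrArg Prod.fst h
    have h2 := congrArg Prod.snd h
    simp only [Prod.fst_add, Prod.fst_sub, Prod.snd_add, Prod.snd_sub] at h1 h2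
    exact Prod.ext (by linarith) (by linarith)
  have hz : z ∈ segment ℝ y (z + (z - y)) := by
    refine ⟨1 / 2, 1 / 2, by norm_num, by norm_num, by norm_num, ?_⟩
    ext <;> simp <;> ring
  have hle := hmax.2 ⟨hsub, _, _, hne, rfl⟩
    ((convex_segment _ _).segment_subset (left_mem_segment ℝ _ _) hz)
  obtain ⟨s, t, hs, ht, hst, h⟩ := hle (right_mem_segment ℝ _ _)
  have h1 := congrArg Prod.fst h
  have h2 := congrArg Prod.snd h
  simp only [Prod.fst_add, Prod.fst_sub, Prod.snd_add, Prod.snd_sub, Prod.smul_fst,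
    Prod.smul_snd, smul_eq_mul] at h1 h2
  obtain rfl : s = 1 - t := by linarith
  apply hyz
  have h1' : (2 - t) * (z.1 - y.1) = 0 := by linarith
  have h2' : (2 - t) * (z.2 - y.2) = 0 := by linarith
  have ht2 : (2 - t) ≠ 0 := by linarith
  exact Prod.ext (by linarith [(mul_eq_zero.1 h1').resolve_left ht2])
    (by linarith [(mul_eq_zero.1 h2').resolve_left ht2])

/-- A face of the Newton polygon does not lie on a supporting line parallel to an axis. -/
lemma face_not_axis {u v c : ℝ} (huv : 0 < u ^ 2 + v ^ 2) (hor : u = 0 ∨ v = 0)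
    (hP : newtonPolyhedron f ⊆ {z : ℝ × ℝ | c ≤ u * z.1 + v * z.2})
    (hup : IsUpperSet (newtonPolyhedron f)) {y z : ℝ × ℝ} (hyz : y ≠ z)
    (hface : segment ℝ y z ∈ newtonFaces f)
    (hyP : y ∈ newtonPolyhedron f) (hzP : z ∈ newtonPolyhedron f)
    (hy : u * y.1 + v * y.2 = c) (hz : u * z.1 + v * z.2 = c) : False := by
  have hcomp : y ≤ z ∨ z ≤ y := by
    rcases hor with rfl | rfl
    · have hv : v ≠ 0 := by rintro rfl; simp at huv
      have : y.2 = z.2 := mul_left_cancel₀ hv (by linarith)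
      exact (le_total y.1 z.1).imp (fun h => ⟨h, this.le⟩) fun h => ⟨h, this.ge⟩
    · have hu : u ≠ 0 := by rintro rfl; simp at huv
      have : y.1 = z.1 := mul_left_cancel₀ hu (by linarith)
      exact (le_total y.2 z.2).imp (fun h => ⟨this.le, h⟩) fun h => ⟨this.ge, h⟩
  wlog hle : y ≤ z generalizing y z
  · exact this hyz.symm (segment_symm ℝ y z ▸ hface) hzP hyP hz hy hcomp.symm
      (hcomp.resolve_left hle)
  refine right_notMem_of_face hyz hface ?_
  rintro _ ⟨s, t, hs, ht, hst, rfl⟩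
  obtain rfl : s = 1 - t := by linarith
  refine mem_frontier_of_halfPlane huv hP (hup ?_ hyP) ?_
  · constructor
    · simp only [Prod.fst_add, Prod.fst_sub, Prod.smul_fst, smul_eq_mul]
      nlinarith [mul_nonneg ht (sub_nonneg.2 hle.1)]
    · simp only [Prod.snd_add, Prod.snd_sub, Prod.smul_snd, smul_eq_mul]
      nlinarith [mul_nonneg ht (sub_nonneg.2 hle.2)]
  · simp only [Prod.fst_add, Prod.fst_sub, Prod.smul_fst, smul_eq_mul, Prod.snd_add,
      Prod.snd_sub, Prod.smul_snd]
    linear_combination (1 - 2 * t) * hy + 2 * t * hz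

/-- An edge on a supporting line is a face as soon as it contains all points of the closure on
that line. -/
lemma segment_mem_newtonFaces {u v c : ℝ} (huv : 0 < u ^ 2 + v ^ 2)
    (hP : newtonPolyhedron f ⊆ {z : ℝ × ℝ | c ≤ u * z.1 + v * z.2}) {y z : ℝ × ℝ} (hyz : y ≠ z)
    (hyP : y ∈ newtonPolyhedron f) (hzP : z ∈ newtonPolyhedron f)
    (hy : u * y.1 + v * y.2 = c) (hz : u * z.1 + v * z.2 = c)
    (hseg : ∀ x ∈ closure (newtonPolyhedron f), u * x.1 + v * x.2 = c → x ∈ segment ℝ y z) :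
    segment ℝ y z ∈ newtonFaces f := by
  refine ⟨⟨?_, y, z, hyz, rfl⟩, ?_⟩
  · intro x hx
    refine mem_frontier_of_halfPlane huv hP (convex_newtonPolyhedron.segment_subset hyP hzP hx) ?_
    obtain ⟨s, t, hs, ht, hst, rfl⟩ := hx
    simp only [Prod.fst_add, Prod.smul_fst, smul_eq_mul, Prod.snd_add, Prod.smul_snd]
    linear_combination s * hy + t * hz + c * hst
  · rintro _ ⟨hsub, y', z', -, rfl⟩ hle
    have hcl : closure (newtonPolyhedron f) ⊆ {z : ℝ × ℝ | c ≤ u * z.1 + v * z.2} :=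
      closure_minimal hP (isClosed_halfPlane u v c)
    have hy' := frontier_subset_closure (hsub (left_mem_segment ℝ y' z'))
    have hz' := frontier_subset_closure (hsub (right_mem_segment ℝ y' z'))
    have hcy := hcl hy'
    have hcz := hcl hz'
    simp only [Set.mem_ofPred_eq] at hcy hcz
    -- At a point where the form attains its minimum `c`, an endpoint off the line has barycentric
    -- weight zero. An endpoint off the line would thus make `y` and `z` both equal to the other
    -- endpoint.
    have haff : ∀ x ∈ segment ℝ y' z', u * x.1 + v * x.2 = c → ∃ s t : ℝ, 0 ≤ s ∧ 0 ≤ t ∧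
        s + t = 1 ∧ s • y' + t • z' = x ∧
        s * (u * y'.1 + v * y'.2 - c) = 0 ∧ t * (u * z'.1 + v * z'.2 - c) = 0 := by
      rintro _ ⟨s, t, hs, ht, hst, rfl⟩ hx
      simp only [Prod.fst_add, Prod.smul_fst, smul_eq_mul, Prod.snd_add, Prod.smul_snd] at hx
      have h1 := mul_nonneg hs (sub_nonneg.2 hcy)
      have h2 := mul_nonneg ht (sub_nonneg.2 hcz)
      have h3 : s * (u * y'.1 + v * y'.2 - c) + t * (u * z'.1 + v * z'.2 - c) = 0 := by
        linear_combination hx - c * hst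
      exact ⟨s, t, hs, ht, hst, rfl, by linarith, by linarith⟩
    obtain ⟨s, t, hs, ht, hst, hxy, h1, h2⟩ := haff y (hle (left_mem_segment ℝ y z)) hy
    obtain ⟨s', t', hs', ht', hst', hxz, h1', h2'⟩ := haff z (hle (right_mem_segment ℝ y z)) hz
    refine (convex_segment y z).segment_subset (hseg _ hy' ?_) (hseg _ hz' ?_)
    · by_contra hne
      have hs0 := (mul_eq_zero.1 h1).resolve_right (sub_ne_zero.2 hne)
      have hs0' := (mul_eq_zero.1 h1').resolve_right (sub_ne_zero.2 hne)
      apply hyz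
      rw [← hxy, ← hxz, hs0, hs0', show t = t' by linarith]
    · by_contra hne
      have hs0 := (mul_eq_zero.1 h2).resolve_right (sub_ne_zero.2 hne)
      have hs0' := (mul_eq_zero.1 h2').resolve_right (sub_ne_zero.2 hne)
      apply hyz
      rw [← hxy, ← hxz, hs0, hs0', show s = s' by linarith]

/-- A linear form with positive coefficients attains its minimum over the exponents of `f` at a
vertex. -/
lemma exists_extreme_min (hf : f ≠ 0) {u v : ℕ} (hu : 0 < u) (hv : 0 < v) :
    ∃ e, coeff e f ≠ 0 ∧ expPoint e ∈ (newtonPolyhedron f).extremePoints ℝ ∧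
      ∀ e', coeff e' f ≠ 0 → u * e 0 + v * e 1 ≤ u * e' 0 + v * e' 1 := by
  obtain ⟨e₀, he₀⟩ : ∃ e, coeff e f ≠ 0 := by
    by_contra! h
    exact hf (ext h)
  -- Ties are broken by the first exponent: the lexicographic half-plane `T` is convex with the
  -- minimum as an extreme point, so no description of the polyhedron is needed.
  let r : (Fin 2 →₀ ℕ) → ℕ ×ₗ ℕ := fun e => toLex (u * e 0 + v * e 1, e 0)
  obtain ⟨e, he, hmin⟩ := (InvImage.wf r wellFounded_lt).has_min {e | coeff e f ≠ 0} ⟨e₀, he₀⟩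
  have hmin' : ∀ e', coeff e' f ≠ 0 → u * e 0 + v * e 1 < u * e' 0 + v * e' 1 ∨
      u * e 0 + v * e 1 = u * e' 0 + v * e' 1 ∧ e 0 ≤ e' 0 := by
    intro e' he'
    have := not_lt.1 (hmin e' he')
    rwa [Prod.Lex.toLex_le_toLex] at this
  have hu' : (0 : ℝ) < u := Nat.cast_pos.2 hu
  have hv' : (0 : ℝ) < v := Nat.cast_pos.2 hv
  let T : Set (ℝ × ℝ) := {z | (u * e 0 + v * e 1 : ℝ) < u * z.1 + v * z.2 ∨
    (u * e 0 + v * e 1 : ℝ) = u * z.1 + v * z.2 ∧ (e 0 : ℝ) ≤ z.1}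
  have hT : Convex ℝ T := by
    intro y hy z hz s t hs ht hst
    rcases hs.eq_or_lt with rfl | hs
    · rw [zero_add] at hst; subst hst; simpa using hz
    rcases ht.eq_or_lt with rfl | ht
    · rw [add_zero] at hst; subst hst; simpa using hy
    obtain rfl : s = 1 - t := by linarith
    simp only [T, Set.mem_ofPred_eq, Prod.fst_add, Prod.snd_add, Prod.smul_fst, Prod.smul_snd,
      smul_eq_mul] at *
    rcases hy with hy | ⟨hy, hy0⟩ <;> rcases hz with hz | ⟨hz, hz0⟩
    · left; nlinarith [mul_lt_mul_of_pos_left hy hs, mul_lt_mul_of_pos_left hz ht]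
    · left; nlinarith [mul_lt_mul_of_pos_left hy hs]
    · left; nlinarith [mul_lt_mul_of_pos_left hz ht]
    · right
      exact ⟨by linear_combination (1 - t) * hy + t * hz,
        by nlinarith [mul_le_mul_of_nonneg_left hy0 hs.le, mul_le_mul_of_nonneg_left hz0 ht.le]⟩
  have hPT : newtonPolyhedron f ⊆ T := by
    refine newtonPolyhedron_subset hT fun e' he' z hz => ?_
    have hz0 : (e' 0 : ℝ) ≤ z.1 := hz.1
    have hz1 : (e' 1 : ℝ) ≤ z.2 := hz.2
    have h0 := mul_le_mul_of_nonneg_left hz0 hu'.le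
    have h1 := mul_le_mul_of_nonneg_left hz1 hv'.le
    rcases hmin' e' he' with h | ⟨h, h2⟩
    · left
      have : (u * e 0 + v * e 1 : ℝ) < u * e' 0 + v * e' 1 := by exact_mod_cast h
      linarith
    · have h3 : (u * e 0 + v * e 1 : ℝ) = u * e' 0 + v * e' 1 := by exact_mod_cast h
      have h4 : (e 0 : ℝ) ≤ e' 0 := by exact_mod_cast h2
      rcases (show (u * e 0 + v * e 1 : ℝ) ≤ u * z.1 + v * z.2 by linarith).lt_or_eq with h5 | h5
      · exact Or.inl h5
      · exact Or.inr ⟨h5, h4.trans hz0⟩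
  refine ⟨e, he, ⟨Ici_subset_newtonPolyhedron he Set.self_mem_Ici, ?_⟩,
    fun e' he' => (hmin' e' he').elim le_of_lt fun h => h.1.le⟩
  rintro y hy z hz ⟨s, t, hs, ht, hst, hyz⟩
  have h0 := congrArg Prod.fst hyz
  have h1 := congrArg Prod.snd hyz
  simp only [Prod.fst_add, Prod.snd_add, Prod.smul_fst, Prod.smul_snd, smul_eq_mul,
    expPoint] at h0 h1
  obtain rfl : s = 1 - t := by linarith
  have key : ∀ x ∈ T, (u * e 0 + v * e 1 : ℝ) ≤ u * x.1 + v * x.2 := fun x hx =>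
    hx.elim le_of_lt fun h => h.1.le
  have hlin : (1 - t) * (u * y.1 + v * y.2 - (u * e 0 + v * e 1)) +
      t * (u * z.1 + v * z.2 - (u * e 0 + v * e 1)) = 0 := by
    linear_combination (u : ℝ) * h0 + (v : ℝ) * h1
  have hy' := key y (hPT hy)
  have hz' := key z (hPT hz)
  have hye : (u * e 0 + v * e 1 : ℝ) = u * y.1 + v * y.2 := by
    nlinarith [mul_nonneg ht.le (sub_nonneg.2 hz')]
  have hze : (u * e 0 + v * e 1 : ℝ) = u * z.1 + v * z.2 := by
    nlinarith [mul_nonneg hs.le (sub_nonneg.2 hy')]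
  have hy0 : (e 0 : ℝ) ≤ y.1 := ((hPT hy).resolve_left hye.not_lt).2
  have hz0 : (e 0 : ℝ) ≤ z.1 := ((hPT hz).resolve_left hze.not_lt).2
  have hy1 : y.1 = e 0 := by nlinarith [mul_nonneg ht.le (sub_nonneg.2 hz0)]
  have hy2 : y.2 = e 1 := by
    rw [hy1] at hye
    exact (mul_left_cancel₀ hv'.ne' (by linarith))
  exact Prod.ext hy1 hy2

end

/-! ### Newton polygon of the form and of series with this principal part. -/

section

variable {K : Type*} [Field K]

lemma coeff_cuspForm (a b : ℕ) (c : K) (e : Fin 2 →₀ ℕ) :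
    coeff e (cuspForm a b c) = (if e 0 = a ∧ e 1 = 0 then 1 else 0) +
      (if e 0 = 2 ∧ e 1 = 2 then c else 0) + (if e 0 = 0 ∧ e 1 = b then 1 else 0) := by
  classical
  have hm : (C c * X 0 ^ 2 * X 1 ^ 2 : Series K) =
      monomial (Finsupp.single 0 2 + Finsupp.single 1 2) c := by
    rw [X_pow_eq, X_pow_eq, mul_assoc, monomial_mul_monomial, ← monomial_zero_eq_C_apply,
      monomial_mul_monomial]
    simp
  have h1 : e = Finsupp.single 0 a ↔ e 0 = a ∧ e 1 = 0 := by
    simp [Finsupp.ext_iff, Fin.forall_fin_two]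
  have h2 : e = Finsupp.single 1 b ↔ e 0 = 0 ∧ e 1 = b := by
    simp [Finsupp.ext_iff, Fin.forall_fin_two]
  have h3 : e = Finsupp.single 0 2 + Finsupp.single 1 2 ↔ e 0 = 2 ∧ e 1 = 2 := by
    simp [Finsupp.ext_iff, Fin.forall_fin_two]
  rw [cuspForm, map_add, map_add, hm, coeff_X_pow, coeff_X_pow, coeff_monomial]
  simp only [h1, h2, h3]

lemma eq_of_coeff_cuspForm_ne_zero {a b : ℕ} {c : K} {e : Fin 2 →₀ ℕ}
    (h : coeff e (cuspForm a b c) ≠ 0) :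
    (e 0 = a ∧ e 1 = 0) ∨ (e 0 = 2 ∧ e 1 = 2) ∨ (e 0 = 0 ∧ e 1 = b) := by
  by_contra! hne
  apply h
  rw [coeff_cuspForm, if_neg (fun h => hne.1 h.1 h.2), if_neg (fun h => hne.2.1 h.1 h.2),
    if_neg (fun h => hne.2.2 h.1 h.2)]
  simp

lemma isUpperSet_nonneg_halfPlane {a b : ℝ} (ha : 0 ≤ a) (hb : 0 ≤ b) (c : ℝ) :
    IsUpperSet {z : ℝ × ℝ | 0 ≤ z.1 ∧ 0 ≤ z.2 ∧ c ≤ b * z.1 + a * z.2} := by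
  rintro y z hyz ⟨h1, h2, h3⟩
  have h4 := mul_le_mul_of_nonneg_left hyz.1 hb
  have h5 := mul_le_mul_of_nonneg_left hyz.2 ha
  exact ⟨h1.trans hyz.1, h2.trans hyz.2, by linarith⟩

/-- If `x² y²` is not below the segment from `x ^ a` to `y ^ b`, it does not matter for the Newton
polyhedron. -/
lemma newtonPolyhedron_cuspForm [CharZero K] {a b : ℕ} (c : K) (hab : a * b ≤ 2 * a + 2 * b) :
    newtonPolyhedron (cuspForm a b c) =
      {z : ℝ × ℝ | 0 ≤ z.1 ∧ 0 ≤ z.2 ∧ (a * b : ℝ) ≤ b * z.1 + a * z.2} := by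
  have hab' : (a * b : ℝ) ≤ 2 * a + 2 * b := by exact_mod_cast hab
  have ha : (0 : ℝ) ≤ a := Nat.cast_nonneg a
  have hb : (0 : ℝ) ≤ b := Nat.cast_nonneg b
  apply Set.Subset.antisymm
  · intro z hz
    have h1 := newtonPolyhedron_subset_halfPlane (f := cuspForm a b c) (u := 1) (v := 0) (c := 0)
      (by norm_num) (by norm_num) (fun e _ => by simp) hz
    have h2 := newtonPolyhedron_subset_halfPlane (f := cuspForm a b c) (u := 0) (v := 1) (c := 0)
      (by norm_num) (by norm_num) (fun e _ => by simp) hz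
    have h3 := newtonPolyhedron_subset_halfPlane (f := cuspForm a b c) (u := b) (v := a)
      (c := a * b) hb ha (fun e he => by
        rcases eq_of_coeff_cuspForm_ne_zero he with ⟨h, h'⟩ | ⟨h, h'⟩ | ⟨h, h'⟩ <;>
          rw [h, h'] <;> push_cast <;> linarith) hz
    simp only [Set.mem_ofPred_eq] at h1 h2 h3
    exact ⟨by linarith, by linarith, h3⟩
  · have hA : Set.Ici ((a : ℝ), (0 : ℝ)) ⊆ newtonPolyhedron (cuspForm a b c) := by
      have := Ici_subset_newtonPolyhedron (f := cuspForm a b c) (e := Finsupp.single 0 a) (by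
        rw [coeff_cuspForm]
        -- If `a = b = 0` the two pure powers merge into the constant `2`, nonzero in characteristic
        -- zero.
        by_cases h : a = 0 ∧ b = 0
        · simp [h.1, h.2, ← two_mul]
        · simp [h, eq_comm (a := (0 : ℕ)) (b := b)])
      simpa [expPoint] using this
    have hB : Set.Ici ((0 : ℝ), (b : ℝ)) ⊆ newtonPolyhedron (cuspForm a b c) := by
      have := Ici_subset_newtonPolyhedron (f := cuspForm a b c) (e := Finsupp.single 1 b) (by
        rw [coeff_cuspForm]
        by_cases h : a = 0 ∧ b = 0
        · simp [h.1, h.2, ← two_mul]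
        · simp [h, eq_comm (a := (0 : ℕ)) (b := a)])
      simpa [expPoint] using this
    rintro ⟨x, y⟩ ⟨hx, hy, hxy⟩
    simp only at hx hy hxy
    by_cases hax : (a : ℝ) ≤ x
    · exact hA ⟨hax, hy⟩
    rw [not_le] at hax
    have ha0 : (0 : ℝ) < a := hx.trans_lt hax
    -- The point is a convex combination, with weights `x / a` and `1 - x / a`, of `(a, 0)` and `(0,
    -- b)` both raised by its height above the line.
    have h1 : ((a : ℝ), y - (b - b * x / a)) ∈ newtonPolyhedron (cuspForm a b c) := by
      refine hA ⟨le_rfl, ?_⟩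
      change 0 ≤ y - (b - b * x / a)
      have : (0 : ℝ) ≤ (b * x + a * y - a * b) / a := div_nonneg (by linarith) ha
      convert this using 1
      field_simp
      ring
    have h2 : ((0 : ℝ), (b : ℝ) + (y - (b - b * x / a))) ∈
        newtonPolyhedron (cuspForm a b c) := by
      refine hB ⟨le_rfl, ?_⟩
      change (b : ℝ) ≤ b + (y - (b - b * x / a))
      have : (0 : ℝ) ≤ (b * x + a * y - a * b) / a := div_nonneg (by linarith) ha
      have h3 : (b * x + a * y - a * b) / a = y - (b - b * x / a) := by field_simp; ring
      linarith
    have := convex_newtonPolyhedron h1 h2 (div_nonneg hx ha)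
      (sub_nonneg.2 ((div_le_one ha0).2 hax.le)) (add_sub_cancel _ _)
    convert this using 1
    ext
    · simp [ha0.ne']
    · simp only [Prod.snd_add, Prod.smul_snd, smul_eq_mul]
      field_simp
      ring

/-- If the form has two faces then `x² y²` lies below the segment from `x ^ a` to `y ^ b`. -/
lemma lt_of_ncard_newtonFaces [CharZero K] {a b : ℕ} {c : K}
    (h : (newtonFaces (cuspForm a b c)).ncard = 2) : 2 * a + 2 * b < a * b := by
  by_contra hab
  have hP := newtonPolyhedron_cuspForm c (not_lt.1 hab)
  set f := cuspForm a b c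
  have ha : (0 : ℝ) ≤ a := Nat.cast_nonneg a
  have hb : (0 : ℝ) ≤ b := Nat.cast_nonneg b
  have hup : IsUpperSet (newtonPolyhedron f) := hP ▸ isUpperSet_nonneg_halfPlane ha hb _
  have hP0 : newtonPolyhedron f ⊆ {z : ℝ × ℝ | 0 ≤ 1 * z.1 + 0 * z.2} := by
    rw [hP]; rintro z ⟨h1, -, -⟩; simpa using h1
  have hP1 : newtonPolyhedron f ⊆ {z : ℝ × ℝ | 0 ≤ 0 * z.1 + 1 * z.2} := by
    rw [hP]; rintro z ⟨-, h1, -⟩; simpa using h1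
  have hP2 : newtonPolyhedron f ⊆ {z : ℝ × ℝ | (a * b : ℝ) ≤ b * z.1 + a * z.2} := by
    rw [hP]; rintro z ⟨-, -, h1⟩; exact h1
  have hclosed : IsClosed (newtonPolyhedron f) := by
    rw [hP]
    exact (isClosed_le continuous_const continuous_fst).inter
      ((isClosed_le continuous_const continuous_snd).inter (isClosed_halfPlane _ _ _))
  have hfr : newtonPolygon f ⊆ newtonPolyhedron f := hclosed.frontier_subset
  have hcases : ∀ z ∈ newtonPolygon f, z.1 = 0 ∨ z.2 = 0 ∨
      (0 < a ∧ 0 < b ∧ (b * z.1 + a * z.2 : ℝ) = a * b) := by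
    intro z hz
    have hzP := hfr hz
    rw [hP] at hzP
    obtain ⟨h0, h1, h2⟩ := hzP
    by_contra! hne
    obtain ⟨hn0, hn1, hn2⟩ := hne
    have h0' := lt_of_le_of_ne h0 hn0.symm
    have h1' := lt_of_le_of_ne h1 hn1.symm
    apply hz.2
    rw [mem_interior]
    by_cases hpos : 0 < a ∧ 0 < b
    · refine ⟨{z : ℝ × ℝ | 0 < z.1} ∩ {z : ℝ × ℝ | 0 < z.2} ∩
        {z : ℝ × ℝ | (a * b : ℝ) < b * z.1 + a * z.2}, ?_, ?_, ⟨⟨h0', h1'⟩,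
          lt_of_le_of_ne h2 (hn2 hpos.1 hpos.2).symm⟩⟩
      · rw [hP]
        rintro y ⟨⟨h3, h4⟩, h5⟩
        exact ⟨le_of_lt h3, le_of_lt h4, le_of_lt h5⟩
      · exact ((isOpen_lt continuous_const continuous_fst).inter
          (isOpen_lt continuous_const continuous_snd)).inter
            (isOpen_lt continuous_const (by fun_prop))
    · refine ⟨{z : ℝ × ℝ | 0 < z.1} ∩ {z : ℝ × ℝ | 0 < z.2}, ?_, ?_, ⟨h0', h1'⟩⟩
      · rw [hP]
        rintro y ⟨h3, h4⟩
        have hz : (a * b : ℝ) = 0 := by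
          rcases Nat.eq_zero_or_pos a with h | h
          · simp [h]
          · simp [Nat.eq_zero_of_not_pos fun h' => hpos ⟨h, h'⟩]
        exact ⟨le_of_lt h3, le_of_lt h4,
          hz.le.trans (add_nonneg (mul_nonneg hb (le_of_lt h3)) (mul_nonneg ha (le_of_lt h4)))⟩
      · exact (isOpen_lt continuous_const continuous_fst).inter
          (isOpen_lt continuous_const continuous_snd)
  have hsub : newtonFaces f ⊆ {segment ℝ ((a : ℝ), (0 : ℝ)) ((0 : ℝ), (b : ℝ))} := by
    intro S hS
    obtain ⟨⟨hSf, y, z, hyz, rfl⟩, hmax⟩ := id hS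
    have hyP := hfr (hSf (left_mem_segment ℝ y z))
    have hzP := hfr (hSf (right_mem_segment ℝ y z))
    -- The midpoint lies on one of three supporting lines; both endpoints are on its nonnegative
    -- side, so they lie on the same line.
    have hmid : (1 / 2 : ℝ) • y + (1 / 2 : ℝ) • z ∈ segment ℝ y z :=
      ⟨1 / 2, 1 / 2, by norm_num, by norm_num, by norm_num, rfl⟩
    have hy0 := hP0 hyP
    have hz0 := hP0 hzP
    have hy1 := hP1 hyP
    have hz1 := hP1 hzP
    have hy2 := hP2 hyP
    have hz2 := hP2 hzP
    simp only [Set.mem_ofPred_eq] at hy0 hz0 hy1 hz1 hy2 hz2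
    have hm := hcases _ (hSf hmid)
    simp only [Prod.fst_add, Prod.snd_add, Prod.smul_fst, Prod.smul_snd, smul_eq_mul] at hm
    rcases hm with hm | hm | ⟨ha0, hb0, hm⟩
    · exact (face_not_axis (by norm_num) (Or.inr rfl) hP0 hup hyz hS hyP hzP
        (by linarith) (by linarith)).elim
    · exact (face_not_axis (by norm_num) (Or.inl rfl) hP1 hup hyz hS hyP hzP
        (by linarith) (by linarith)).elim
    · have ha0' : (0 : ℝ) < a := Nat.cast_pos.2 ha0
      have hb0' : (0 : ℝ) < b := Nat.cast_pos.2 hb0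
      have hmem : ∀ x : ℝ × ℝ, 0 ≤ x.1 → 0 ≤ x.2 → (b * x.1 + a * x.2 : ℝ) = a * b →
          x ∈ segment ℝ ((a : ℝ), (0 : ℝ)) ((0 : ℝ), (b : ℝ)) := by
        intro x h1 h2 h3
        refine ⟨x.1 / a, x.2 / b, div_nonneg h1 ha, div_nonneg h2 hb, ?_, ?_⟩
        · field_simp; linarith
        · ext <;> simp [ha0'.ne', hb0'.ne']
      rw [Set.mem_singleton_iff]
      refine Set.Subset.antisymm ((convex_segment _ _).segment_subset
        (hmem y (by linarith) (by linarith) (by linarith))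
        (hmem z (by linarith) (by linarith) (by linarith))) (hmax ⟨?_, _, _, ?_, rfl⟩ ?_)
      · rintro _ ⟨s, t, hs, ht, hst, rfl⟩
        refine mem_frontier_of_halfPlane (by positivity) hP2 ?_ ?_
        · rw [hP]
          refine ⟨?_, ?_, le_of_eq ?_⟩ <;>
            simp only [Prod.fst_add, Prod.snd_add, Prod.smul_fst, Prod.smul_snd, smul_eq_mul]
          · nlinarith [mul_nonneg hs ha]
          · nlinarith [mul_nonneg ht hb]
          · linear_combination (-(a * b) : ℝ) * hst
        · simp only [Prod.fst_add, Prod.snd_add, Prod.smul_fst, Prod.smul_snd, smul_eq_mul]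
          linear_combination (a * b : ℝ) * hst
      · intro heq
        exact ha0'.ne' (congrArg Prod.fst heq)
      · exact (convex_segment _ _).segment_subset
          (hmem y (by linarith) (by linarith) (by linarith))
          (hmem z (by linarith) (by linarith) (by linarith))
  have hle := Set.ncard_le_ncard hsub (Set.finite_singleton _)
  rw [h, Set.ncard_singleton] at hle
  omega

lemma coeff_principalPart_of_mem {f : Series K} {e : Fin 2 →₀ ℕ}
    (h : expPoint e ∈ compactPart f) : coeff e (principalPart f) = coeff e f := by
  classical
  change (if expPoint e ∈ compactPart f then coeff e f else 0) = _
  rw [if_pos h]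

lemma coeff_principalPart_of_notMem {f : Series K} {e : Fin 2 →₀ ℕ}
    (h : expPoint e ∉ compactPart f) : coeff e (principalPart f) = 0 := by
  classical
  change (if expPoint e ∈ compactPart f then coeff e f else 0) = _
  rw [if_neg h]

lemma coeff_eq_of_coeff_principalPart_ne_zero {f : Series K} {e : Fin 2 →₀ ℕ}
    (h : coeff e (principalPart f) ≠ 0) : coeff e f = coeff e (principalPart f) := by
  by_cases he : expPoint e ∈ compactPart f
  · exact (coeff_principalPart_of_mem he).symm
  · exact absurd (coeff_principalPart_of_notMem he) h

/-- A series with principal part `x ^ a + c x² y² + y ^ b` differs from it by terms strictly above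
both edges. -/
lemma sub_mem_newtonIdeal {p q : ℕ} {c : K} (hc : c ≠ 0) (hpq : 4 < p * q) {f : Series K}
    (hprin : principalPart f = cuspForm (p + 2) (q + 2) c) :
    f - cuspForm (p + 2) (q + 2) c ∈ newtonIdeal K p q (2 * (p + 2) * (q + 2) + 1) := by
  have hp : 0 < p := Nat.pos_of_ne_zero (by rintro rfl; simp at hpq)
  have hq : 0 < q := Nat.pos_of_ne_zero (by rintro rfl; simp at hpq)
  have hpq' : (4 : ℝ) < p * q := by exact_mod_cast hpq
  have hp' : (0 : ℝ) < p := Nat.cast_pos.2 hp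
  have hq' : (0 : ℝ) < q := Nat.cast_pos.2 hq
  have hP : ∀ e, coeff e (cuspForm (p + 2) (q + 2) c) ≠ 0 →
      expPoint e ∈ newtonPolyhedron f := by
    intro e he
    rw [← hprin] at he
    refine Ici_subset_newtonPolyhedron ?_ Set.self_mem_Ici
    rwa [coeff_eq_of_coeff_principalPart_ne_zero he]
  have hA : ((p + 2 : ℝ), (0 : ℝ)) ∈ newtonPolyhedron f := by
    have := hP (Finsupp.single 0 (p + 2)) (by rw [coeff_cuspForm]; simp)
    simpa [expPoint] using this
  have hM : ((2 : ℝ), (2 : ℝ)) ∈ newtonPolyhedron f := by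
    have := hP (Finsupp.single 0 2 + Finsupp.single 1 2) (by rw [coeff_cuspForm]; simpa using hc)
    simpa [expPoint] using this
  have hB : ((0 : ℝ), (q + 2 : ℝ)) ∈ newtonPolyhedron f := by
    have := hP (Finsupp.single 1 (q + 2)) (by rw [coeff_cuspForm]; simp)
    simpa [expPoint] using this
  have hf0 : f ≠ 0 := by
    rintro rfl
    have h0 : newtonPolyhedron (0 : Series K) ⊆ ∅ :=
      newtonPolyhedron_subset convex_empty (by simp)
    exact h0 hM
  -- Vertices belong to the compact part, so the principal part controls them. As each edge form
  -- attains its minimum over `f` at a vertex, it suffices to test three points.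
  have hvertex : ∀ e, coeff e f ≠ 0 → expPoint e ∈ (newtonPolyhedron f).extremePoints ℝ →
      (e 0 = p + 2 ∧ e 1 = 0) ∨ (e 0 = 2 ∧ e 1 = 2) ∨ (e 0 = 0 ∧ e 1 = q + 2) := by
    intro e he hext
    refine eq_of_coeff_cuspForm_ne_zero (c := c) ?_
    rwa [← hprin, coeff_principalPart_of_mem (Or.inr hext)]
  have hleft : ∀ e : Fin 2 →₀ ℕ, coeff e f ≠ 0 → 2 * (p + 2) ≤ 2 * e 0 + p * e 1 := by
    obtain ⟨e, he, hext, hmin⟩ := exists_extreme_min hf0 two_pos hp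
    refine fun e' he' => le_trans ?_ (hmin e' he')
    rcases hvertex e he hext with ⟨h0, h1⟩ | ⟨h0, h1⟩ | ⟨h0, h1⟩ <;> rw [h0, h1] <;> nlinarith
  have hright : ∀ e : Fin 2 →₀ ℕ, coeff e f ≠ 0 → 2 * (q + 2) ≤ q * e 0 + 2 * e 1 := by
    obtain ⟨e, he, hext, hmin⟩ := exists_extreme_min hf0 hq two_pos
    refine fun e' he' => le_trans ?_ (hmin e' he')
    rcases hvertex e he hext with ⟨h0, h1⟩ | ⟨h0, h1⟩ | ⟨h0, h1⟩ <;> rw [h0, h1] <;> nlinarith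
  have hPleft : newtonPolyhedron f ⊆ {z : ℝ × ℝ | (2 * (p + 2) : ℝ) ≤ 2 * z.1 + p * z.2} :=
    newtonPolyhedron_subset_halfPlane two_pos.le hp'.le
      fun e he => by exact_mod_cast hleft e he
  have hPright : newtonPolyhedron f ⊆ {z : ℝ × ℝ | (2 * (q + 2) : ℝ) ≤ q * z.1 + 2 * z.2} :=
    newtonPolyhedron_subset_halfPlane hq'.le two_pos.le
      fun e he => by exact_mod_cast hright e he
  have hP0 : newtonPolyhedron f ⊆ {z : ℝ × ℝ | 0 ≤ 1 * z.1 + 0 * z.2} :=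
    newtonPolyhedron_subset_halfPlane one_pos.le le_rfl fun e _ => by simp
  have hP1 : newtonPolyhedron f ⊆ {z : ℝ × ℝ | 0 ≤ 0 * z.1 + 1 * z.2} :=
    newtonPolyhedron_subset_halfPlane le_rfl one_pos.le fun e _ => by simp
  have hsegL : ∀ x ∈ closure (newtonPolyhedron f), (2 * x.1 + p * x.2 : ℝ) = 2 * (p + 2) →
      x ∈ segment ℝ ((p + 2 : ℝ), (0 : ℝ)) ((2 : ℝ), (2 : ℝ)) := by
    intro x hx hxl
    have h1 := closure_minimal hP1 (isClosed_halfPlane _ _ _) hx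
    have h2 := closure_minimal hPright (isClosed_halfPlane _ _ _) hx
    simp only [Set.mem_ofPred_eq] at h1 h2
    have hx1 : x.1 = p + 2 - p * x.2 / 2 := by linarith
    -- On the left line, the inequality of the right edge says exactly that the point is not beyond
    -- `(2, 2)`.
    have h3 : (p * q - 4) * (2 - x.2) ≥ 0 := by rw [hx1] at h2; nlinarith
    have h4 := nonneg_of_mul_nonneg_right h3 (by linarith : (0 : ℝ) < p * q - 4)
    refine ⟨1 - x.2 / 2, x.2 / 2, by linarith, by linarith, by ring, ?_⟩
    ext
    · simp only [Prod.fst_add, Prod.smul_fst, smul_eq_mul]; rw [hx1]; ring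
    · simp only [Prod.snd_add, Prod.smul_snd, smul_eq_mul]; ring
  have hsegR : ∀ x ∈ closure (newtonPolyhedron f), (q * x.1 + 2 * x.2 : ℝ) = 2 * (q + 2) →
      x ∈ segment ℝ ((0 : ℝ), (q + 2 : ℝ)) ((2 : ℝ), (2 : ℝ)) := by
    intro x hx hxl
    have h1 := closure_minimal hP0 (isClosed_halfPlane _ _ _) hx
    have h2 := closure_minimal hPleft (isClosed_halfPlane _ _ _) hx
    simp only [Set.mem_ofPred_eq] at h1 h2
    have hx1 : x.2 = q + 2 - q * x.1 / 2 := by linarith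
    have h3 : (p * q - 4) * (2 - x.1) ≥ 0 := by rw [hx1] at h2; nlinarith
    have h4 := nonneg_of_mul_nonneg_right h3 (by linarith : (0 : ℝ) < p * q - 4)
    refine ⟨1 - x.1 / 2, x.1 / 2, by linarith, by linarith, by ring, ?_⟩
    ext
    · simp only [Prod.fst_add, Prod.smul_fst, smul_eq_mul]; ring
    · simp only [Prod.snd_add, Prod.smul_snd, smul_eq_mul]; rw [hx1]; ring
  have hfaceL := segment_mem_newtonFaces (f := f) (by positivity) hPleft
    (fun h => by simpa using congrArg Prod.snd h) hA hM (by simp) (by simp; ring) hsegL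
  have hfaceR := segment_mem_newtonFaces (f := f) (by positivity) hPright
    (fun h => by simpa using congrArg Prod.fst h) hB hM (by simp) (by simp; ring) hsegR
  -- A term of `f` on either line lies on a face, hence belongs to the principal part and cancels;
  -- integrality turns strict inequality into `+ 1`.
  have habove : ∀ e, coeff e (f - cuspForm (p + 2) (q + 2) c) ≠ 0 →
      2 * (p + 2) + 1 ≤ 2 * e 0 + p * e 1 ∧ 2 * (q + 2) + 1 ≤ q * e 0 + 2 * e 1 := by
    intro e he
    rw [map_sub, ← hprin] at he
    have hnot : expPoint e ∉ compactPart f := by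
      intro h
      rw [coeff_principalPart_of_mem h, sub_self] at he
      exact he rfl
    rw [coeff_principalPart_of_notMem hnot, sub_zero] at he
    have hcl := subset_closure (Ici_subset_newtonPolyhedron he Set.self_mem_Ici)
    constructor
    · refine lt_of_le_of_ne (hleft e he) fun heq => hnot (Or.inl ⟨_, hfaceL, hsegL _ hcl ?_⟩)
      simp only [expPoint]
      exact_mod_cast heq.symm
    · refine lt_of_le_of_ne (hright e he) fun heq => hnot (Or.inl ⟨_, hfaceR, hsegR _ hcl ?_⟩)
      simp only [expPoint]
      exact_mod_cast heq.symm
  constructor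
  · intro e he
    have := Nat.mul_le_mul_right (q + 2) (habove e he).1
    simp only [expWeight, leftWeight, Matrix.cons_val_zero, Matrix.cons_val_one]
    nlinarith
  · intro e he
    have := Nat.mul_le_mul_right (p + 2) (habove e he).2
    simp only [expWeight, rightWeight, Matrix.cons_val_zero, Matrix.cons_val_one]
    nlinarith

end

end PlaneSeries

end

theorem mainTheorem2 {K : Type*} [RCLike K] (a b : ℕ) (c : K) (hc : c ≠ 0)
    (hfaces : (PlaneSeries.newtonFaces (PlaneSeries.cuspForm a b c)).ncard = 2)
    (f : PlaneSeries.Series K) (hf : PlaneSeries.IsNondegenerate f)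
    (hprin : PlaneSeries.principalPart f = PlaneSeries.cuspForm a b c) :
    PlaneSeries.RightEquivalent f (PlaneSeries.cuspForm a b c) := by
  have hab := PlaneSeries.lt_of_ncard_newtonFaces hfaces
  have ha : 2 < a := by
    by_contra h
    have := Nat.mul_le_mul_right b (not_lt.1 h)
    omega
  have hb : 2 < b := by
    by_contra h
    have := Nat.mul_le_mul_left a (not_lt.1 h)
    omega
  obtain ⟨p, rfl⟩ : ∃ p, a = p + 2 := ⟨a - 2, by omega⟩
  obtain ⟨q, rfl⟩ : ∃ q, b = q + 2 := ⟨b - 2, by omega⟩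
  -- The inequality `2a + 2b < ab` is `(a - 2) (b - 2) > 4`.
  have hpq : 4 < p * q := by nlinarith
  exact PlaneSeries.rightEquivalent_of_sub_mem hc hpq
    (PlaneSeries.sub_mem_newtonIdeal hc hpq hprin)
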